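/- Let $n\ge 1$ and $0\le k\le n-1$ be integers. For $l\ge 0$ let $S_l$ be the elementary symmetric polynomial of degree $l$ in $n$ variables ($S_0=1$), let $Q_k=S_{k+1}/S_k$, and let $\Gamma_{k+1}=\{\lambda\in\mathbb R^n : S_l(\lambda)>0,\ l=0,\dots,k+1\}$. For a function $u$ put $w=\sqrt{1+|Du|^2}$; the principal curvatures of its graph are the eigenvalues of the symmetric matrix $$A_{ij}=\frac1w\Big(u_{ij}-\frac{u_iu_ku_{kj}}{w(1+w)}-\frac{u_ju_ku_{ki}}{w(1+w)}+\frac{u_iu_ju_ku_lu_{kl}}{w^2(1+w)^2}\Big)$$ (in this formula repeated indices $k,l$ are summed from $1$ to $n$), and $Q_k(Du,D^2u)$ denotes $Q_k$ evaluated at these principal curvatures. There is a constant $K=K(k,n)>0$ with the following property. Let $r>0$, $T>0$, $\Omega=B_r(0)\times(0,T]\subset\mathbb R^n\times\mathbb R$, and let $u:\Omega\to\mathbb R$ be a bounded classical solution of $$u_t=Q_k(Du,D^2u)\sqrt{1+|Du|^2}\quad\text{in }\Omega ,$$ that is, $u(\cdot,t)$ is $C^3$ on $B_r(0)$ for every $t\in(0,T]$,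 the spatial derivatives of $u$ up to order three are continuous on $\Omega$, and $u$ is differentiable in $t$ (from the left at $t=T$) and satisfies the equation. Assume that the principal curvatures of the graph of $u(\cdot,t)$ lie in $\Gamma_{k+1}$ at every point of $B_r(0)$, for each $t\in(0,T]$. Let $M=\sup_\Omega u-\inf_\Omega u$ (so $M\le\sup_\Omega u$ if $u>0$). Then for every $t\in(0,T]$ $$|Du(0,t)|\le\exp\left(K+\frac{KMT}{rt}+K\Big(\frac{MrT}{t}+\frac{M^2}{t}+\frac{(T+1)r^2}{t}+\frac{TM^2}{tr^2}+\frac{TM}{tr}\Big)\right).$$ -/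

import Mathlib

open Set

noncomputable section

/-- `w = √(1 + |Df|²)`. -/
def slopeFactor {n : ℕ} (f : EuclideanSpace ℝ (Fin n) → ℝ) (x : EuclideanSpace ℝ (Fin n)) : ℝ :=
  Real.sqrt (1 + ‖gradient f x‖ ^ 2)

/-- The Hessian matrix `(f_ij)` of second partial derivatives. -/
def hessianMatrix {n : ℕ} (f : EuclideanSpace ℝ (Fin n) → ℝ) (x : EuclideanSpace ℝ (Fin n)) :
    Matrix (Fin n) (Fin n) ℝ :=
  Matrix.of fun i j =>
    iteratedFDeriv ℝ 2 f x ![EuclideanSpace.single i 1, EuclideanSpace.single j 1]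

/-- The symmetrized Weingarten matrix of the graph of `f`:
`A_ij = w⁻¹ (f_ij - f_i f_k f_kj / (w(1+w)) - f_j f_k f_ki / (w(1+w))
  + f_i f_j f_k f_l f_kl / (w²(1+w)²))`, with summation over `k` and `l`. -/
def weingartenMatrix {n : ℕ} (f : EuclideanSpace ℝ (Fin n) → ℝ) (x : EuclideanSpace ℝ (Fin n)) :
    Matrix (Fin n) (Fin n) ℝ :=
  let w := slopeFactor f x
  let p := gradient f x
  let H := hessianMatrix f x
  Matrix.of fun i j => w⁻¹ *
    (H i j - (∑ k, p i * p k * H k j) / (w * (1 + w)) - (∑ k, p j * p k * H k i) / (w * (1 + w))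
      + (∑ k, ∑ l, p i * p j * p k * p l * H k l) / (w ^ 2 * (1 + w) ^ 2))

/-- The principal curvatures of the graph of `f` over the point `x` (upward convex graphs having
positive curvatures): the eigenvalues, counted with multiplicity, of the Weingarten matrix. That
matrix is symmetric where `f` is `C²`, so there all the `n` roots are real. -/
def principalCurvatures {n : ℕ} (f : EuclideanSpace ℝ (Fin n) → ℝ)
    (x : EuclideanSpace ℝ (Fin n)) : Multiset ℝ :=
  (weingartenMatrix f x).charpoly.roots

/-- The cone `Γ_m = {λ : S_l(λ) > 0, l = 0, …, m}`, where `S_l` is the elementary symmetric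
polynomial of degree `l` (with `S_0 = 1`, and `S_l = 0` when `l` exceeds the number of
variables). -/
def gammaCone (m : ℕ) : Set (Multiset ℝ) :=
  {lam | ∀ l ≤ m, 0 < lam.esymm l}

/-- The curvature quotient `Q_k = S_{k+1} / S_k`. -/
def curvatureQuotient (k : ℕ) (lam : Multiset ℝ) : ℝ :=
  lam.esymm (k + 1) / lam.esymm k

/-- The space-time cylinder `B_r(0) × (0, T]`. -/
def flowCylinder (n : ℕ) (r T : ℝ) : Set (EuclideanSpace ℝ (Fin n) × ℝ) :=
  Metric.ball 0 r ×ˢ Ioc 0 T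

/-- `u` is a classical solution on `B_r(0) × (0, T]` of the graphical flow
`u_t = Q_k(Du, D²u) √(1 + |Du|²)`: it is three times differentiable in space, its spatial
derivatives up to order three are jointly continuous in space and time, and it is differentiable in
time (from the left at time `T`) with the time derivative prescribed by the equation. -/
structure IsGraphicalFlow {n : ℕ} (k : ℕ) (r T : ℝ)
    (u : EuclideanSpace ℝ (Fin n) → ℝ → ℝ) : Prop where
  contDiffOn : ∀ t ∈ Ioc 0 T, ContDiffOn ℝ 3 (fun x => u x t) (Metric.ball 0 r)
  continuousOn : ∀ j ≤ 3, ContinuousOn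
    (fun z : EuclideanSpace ℝ (Fin n) × ℝ => iteratedFDeriv ℝ j (fun x => u x z.2) z.1)
    (flowCylinder n r T)
  equation : ∀ x ∈ Metric.ball (0 : EuclideanSpace ℝ (Fin n)) r, ∀ t ∈ Ioc 0 T,
    HasDerivWithinAt (fun s => u x s)
      (curvatureQuotient k (principalCurvatures (fun y => u y t) x)
        * slopeFactor (fun y => u y t) x) (Ioc 0 T) t

/-- The set of values that `u` takes on `B_r(0) × (0, T]`. -/
def flowValues {n : ℕ} (r T : ℝ) (u : EuclideanSpace ℝ (Fin n) → ℝ → ℝ) : Set ℝ :=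
  (fun z : EuclideanSpace ℝ (Fin n) × ℝ => u z.1 z.2) '' flowCylinder n r T

end

/-! The maximum principle is applied to `(exp (C φ) - 1) w` with φ = (t/T)(1 - |x|²/r²) + (u -
m)/(2N) - 1/4, m = sup u and N = M + r. Since u ≤ m, φ is positive only on a part of the cylinder
that stays away from the lateral and initial boundary, while u ≥ m - N gives φ(0, T) ≥ 1/4. Hence a
maximum is attained at some (x, t) with φ > 0, where possibly t = T.

Freeze p = Du(x, t) and put V = 1 + ⟨Du, p⟩. By Cauchy-Schwarz V ≤ w(x, t) w, with equality at (x,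
t), so `(exp (C φ) - 1) V` has a local maximum there too, and V is affine in Du. The flow reads u_t
= Q(g⁻¹ D²u) with g the metric of the graph. Differentiating it along p, in a g-orthonormal frame in
which D²u is diagonal with entries λ_i, gives V_t = ∑ a_i (V_ii - 2 V_i²/V), a_i = ∂Q/∂λ_i
(`IsGraphicalFlow.hasDerivWithinAt_fderiv`). The first order condition turns the cross terms of the
second order condition into exactly this quadratic term, which leaves ∑ a_i φ_ii + C ∑ a_i φ_i² ≤
φ_t (`maximum_principle_inequality`). As Q has degree one, ∑ a_i λ_i = Q, so u drops out of the
difference of φ_t and ∑ a_i φ_ii; the rest is bounded through ∑ a_i ≤ n (`sum_quotDeriv_le`).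

If |p| > 8N/r, then ∑ p_i φ_i ≥ 1/(8N). The first order condition makes φ_i a negative multiple of
λ_i p_i, so only indices with λ_i ≤ 0 help, and there a_i ≥ 1/n (`quotDeriv_ge_of_nonpos`, from
Newton's inequality). Then C ∑ a_i φ_i² ≥ C/(64 n N²), too large for the chosen C. So |p| ≤ 8N/r,
and comparing the test function at (x, t) and (0, T) gives the estimate. -/

/-! ### Elementary symmetric functions of a finite family -/

/-- The elementary symmetric function of degree `l` of the family `lam` restricted to `s`. -/
def esym {ι : Type*} (lam : ι → ℝ) (s : Finset ι) (l : ℕ) : ℝ :=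
  ∑ t ∈ s.powersetCard l, ∏ i ∈ t, lam i

section esym

variable {ι : Type*} (lam : ι → ℝ)

theorem esym_zero (s : Finset ι) : esym lam s 0 = 1 := by
  simp [esym]

theorem esym_eq_zero {s : Finset ι} {l : ℕ} (h : s.card < l) : esym lam s l = 0 := by
  simp [esym, Finset.powersetCard_eq_empty.2 h]

theorem esym_eq_coeff (s : Finset ι) {l : ℕ} (h : l ≤ s.card) :
    esym lam s l = (∏ i ∈ s, (Polynomial.X + Polynomial.C (lam i))).coeff (s.card - l) := by
  rw [Finset.prod_X_add_C_coeff s lam (Nat.sub_le _ _), Nat.sub_sub_self h, esym]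

theorem esym_eq_multiset_esymm [Fintype ι] (l : ℕ) :
    (Finset.univ.val.map lam).esymm l = esym lam Finset.univ l :=
  Finset.esymm_map_val lam Finset.univ l

theorem esym_succ [DecidableEq ι] {s : Finset ι} {i : ι} (hi : i ∈ s) (l : ℕ) :
    esym lam s (l + 1) = lam i * esym lam (s.erase i) l + esym lam (s.erase i) (l + 1) := by
  have hs : s = insert i (s.erase i) := (Finset.insert_erase hi).symm
  have hni : i ∉ s.erase i := Finset.notMem_erase i s
  conv_lhs => rw [esym, hs, Finset.powersetCard_succ_insert hni]
  rw [Finset.sum_union, Finset.sum_image, add_comm]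
  · congr 1
    rw [esym, Finset.mul_sum]
    refine Finset.sum_congr rfl fun t ht => ?_
    rw [Finset.prod_insert fun h => hni ((Finset.mem_powersetCard.1 ht).1 h)]
  · intro t ht t' ht' h
    have h1 : i ∉ t := fun h => hni ((Finset.mem_powersetCard.1 ht).1 h)
    have h2 : i ∉ t' := fun h => hni ((Finset.mem_powersetCard.1 ht').1 h)
    rw [← Finset.erase_insert h1, ← Finset.erase_insert h2]
    exact congrArg (fun z => Finset.erase z i) h
  · rw [Finset.disjoint_left]
    intro t ht ht'
    obtain ⟨t', -, rfl⟩ := Finset.mem_image.1 ht'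
    exact hni ((Finset.mem_powersetCard.1 ht).1 (Finset.mem_insert_self _ _))

end esym

/-! ### Laguerre's inequality and real-rootedness of derivatives -/

section Laguerre

open Polynomial

/-- Laguerre's inequality for polynomials with only real roots. -/
theorem laguerre_prod_X_sub_C (s : Multiset ℝ) (x : ℝ) :
    0 ≤ ((s.map fun a => X - C a).prod.derivative.eval x) ^ 2
      - (s.map fun a => X - C a).prod.eval x
        * (s.map fun a => X - C a).prod.derivative.derivative.eval x := by
  induction s using Multiset.induction_on with
  | empty => simp
  | cons a s ih =>
    simp only [Multiset.map_cons, Multiset.prod_cons]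
    generalize (s.map fun a => X - C a).prod = q at ih ⊢
    simp only [derivative_mul, derivative_sub, derivative_X, derivative_C, sub_zero, one_mul,
      derivative_add, eval_add, eval_mul, eval_sub, eval_X, eval_C]
    -- For p = (X - a) q one has p'² - p p'' = q² + (x - a)² (q'² - q q'').
    nlinarith [sq_nonneg (q.eval x), mul_nonneg (sq_nonneg (x - a)) ih]

theorem Polynomial.Splits.laguerre {p : ℝ[X]} (hp : p.Splits) (x : ℝ) :
    0 ≤ (p.derivative.eval x) ^ 2 - p.eval x * p.derivative.derivative.eval x := by
  have h := hp.eq_prod_roots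
  have hl := laguerre_prod_X_sub_C p.roots x
  rw [h]
  generalize (p.roots.map fun a => X - C a).prod = q at hl ⊢
  simp only [derivative_mul, derivative_C, zero_mul, zero_add, eval_mul, eval_C]
  nlinarith [mul_nonneg (sq_nonneg p.leadingCoeff) hl]

/-- By Rolle, counted with multiplicity, differentiation loses at most one real root, and it lowers
the degree by at least one; so the derivative has as many roots as its degree. -/
theorem Polynomial.Splits.derivative_real {p : ℝ[X]} (hp : p.Splits) : p.derivative.Splits := by
  rcases Nat.eq_zero_or_pos p.natDegree with h0 | h0
  · rw [derivative_of_natDegree_zero h0]; exact Polynomial.Splits.zero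
  rw [splits_iff_card_roots] at hp ⊢
  have h1 := card_roots_le_derivative p
  have h2 := p.derivative.card_roots'
  have h3 := natDegree_derivative_lt (p := p) (by omega)
  omega

theorem Polynomial.Splits.iterate_derivative_real {p : ℝ[X]} (hp : p.Splits) (j : ℕ) :
    (derivative^[j] p).Splits := by
  induction j with
  | zero => exact hp
  | succ j ih => rw [Function.iterate_succ_apply']; exact ih.derivative_real

end Laguerre

/-! ### Newton's inequality and the partial derivatives of the quotient -/

section Newton

variable {ι : Type*} (lam : ι → ℝ)

open Polynomial in
/-- A strict form of Newton's inequality. -/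
theorem esym_newton (s : Finset ι) (k : ℕ) :
    (esym lam s (k + 1)) ^ 2 / (s.card + 1 : ℝ)
      ≤ (esym lam s (k + 1)) ^ 2 - esym lam s k * esym lam s (k + 2) := by
  have hm : (0 : ℝ) < s.card + 1 := by positivity
  rcases lt_or_ge s.card (k + 2) with h | h
  · rw [esym_eq_zero lam h, mul_zero, sub_zero]
    exact div_le_self (sq_nonneg _) (by linarith [(Nat.cast_nonneg s.card : (0 : ℝ) ≤ s.card)])
  -- Up to factorials, the three lowest coefficients of the `j`-th derivative of ∏ (X + λ_i) are
  -- S_{k+2}, S_{k+1}, S_k. Laguerre's inequality at 0 then reads (j + 1) S_{k+1}² ≥ (j + 2) S_k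
  -- S_{k+2}, which is weaker than the sharp Newton inequality but leaves the gap S_{k+1}²/(j + 2).
  obtain ⟨j, hj⟩ : ∃ j, s.card = j + k + 2 := ⟨s.card - (k + 2), by omega⟩
  set p : ℝ[X] := ∏ i ∈ s, (X + C (lam i)) with hpdef
  have hsplit : p.Splits := Polynomial.Splits.prod fun i _ => Polynomial.Splits.X_add_C _
  have hl := (hsplit.iterate_derivative_real j).laguerre 0
  rw [← Function.iterate_succ_apply' derivative, ← Function.iterate_succ_apply' derivative] at hl
  simp only [← coeff_zero_eq_eval_zero, coeff_iterate_derivative, zero_add,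
    Nat.descFactorial_self, nsmul_eq_mul] at hl
  have e0 : p.coeff j = esym lam s (k + 2) := by
    rw [esym_eq_coeff lam s (by omega)]; congr 1; omega
  have e1 : p.coeff (j + 1) = esym lam s (k + 1) := by
    rw [esym_eq_coeff lam s (by omega)]; congr 1; omega
  have e2 : p.coeff (j + 2) = esym lam s k := by
    rw [esym_eq_coeff lam s (by omega)]; congr 1; omega
  simp only [Nat.succ_eq_add_one, e0, e1, add_assoc, Nat.reduceAdd, e2] at hl
  rw [Nat.factorial_succ (j + 1), Nat.factorial_succ j] at hl
  push_cast at hl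
  have hf : (0 : ℝ) < (Nat.factorial j : ℝ) := by positivity
  have hj0 : (0 : ℝ) ≤ j := Nat.cast_nonneg j
  have key : 0 ≤ ((j : ℝ) + 1) * (esym lam s (k + 1)) ^ 2
      - (j + 2) * (esym lam s k * esym lam s (k + 2)) := by
    have : 0 ≤ (((j : ℝ) + 1) * (Nat.factorial j : ℝ) ^ 2) *
      (((j : ℝ) + 1) * (esym lam s (k + 1)) ^ 2
      - (j + 2) * (esym lam s k * esym lam s (k + 2))) := by
      refine hl.trans_eq ?_
      ring
    exact nonneg_of_mul_nonneg_right this (by positivity)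
  have hle : (j : ℝ) + 2 ≤ s.card + 1 := by rw [hj]; push_cast; linarith [(Nat.cast_nonneg k : (0 : ℝ) ≤ k)]
  calc (esym lam s (k + 1)) ^ 2 / (s.card + 1 : ℝ)
      ≤ (esym lam s (k + 1)) ^ 2 / ((j : ℝ) + 2) := by gcongr
    _ ≤ _ := by
      rw [div_le_iff₀ (by positivity)]
      linarith

/-- The partial derivative of the elementary symmetric function of degree `l` in the variable
of index `i`. -/
def esymDeriv [Fintype ι] [DecidableEq ι] (i : ι) : ℕ → ℝ
  | 0 => 0
  | l + 1 => esym lam (Finset.univ.erase i) l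

/-- The partial derivative of the quotient `S_{k+1} / S_k` in the variable of index `i`. -/
noncomputable def quotDeriv [Fintype ι] [DecidableEq ι] (k : ℕ) (i : ι) : ℝ :=
  (esymDeriv lam i (k + 1) * esym lam Finset.univ k
    - esym lam Finset.univ (k + 1) * esymDeriv lam i k) / (esym lam Finset.univ k) ^ 2

variable [Fintype ι] [DecidableEq ι]

theorem esym_eq_add_esymDeriv (i : ι) (l : ℕ) :
    esym lam Finset.univ l = lam i * esymDeriv lam i l + esym lam (Finset.univ.erase i) l := by
  cases l with
  | zero => simp [esymDeriv, esym_zero]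
  | succ l => exact esym_succ lam (Finset.mem_univ i) l

open Polynomial in
-- The derivative of ∏ (X + λ_i) is the sum over i of the products without the i-th factor; compare
-- coefficients. For `l` equal to the number of variables both sides vanish, and this case is split
-- off because of the truncated exponent.
theorem sum_esym_erase (l : ℕ) (hl : l ≤ Fintype.card ι) :
    ∑ i, esym lam (Finset.univ.erase i) l = (Fintype.card ι - l : ℝ) * esym lam Finset.univ l := by
  rcases hl.eq_or_lt with rfl | hl
  · rw [sub_self, zero_mul]
    refine Finset.sum_eq_zero fun i _ => esym_eq_zero lam ?_
    rw [Finset.card_erase_of_mem (Finset.mem_univ i), Finset.card_univ]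
    have := Fintype.card_pos_iff.2 ⟨i⟩
    omega
  have h := congrArg (fun q : ℝ[X] => q.coeff (Fintype.card ι - 1 - l))
    (derivative_prod_finset (s := Finset.univ) (f := fun i : ι => X + C (lam i)))
  simp only [derivative_add, derivative_X, derivative_C, add_zero, mul_one, coeff_derivative,
    finsetSum_coeff] at h
  have h1 : Fintype.card ι - 1 - l + 1 = Fintype.card ι - l := by omega
  rw [h1] at h
  rw [esym_eq_coeff lam Finset.univ (by rw [Finset.card_univ]; exact hl.le), Finset.card_univ]
  have h2 : ((Fintype.card ι - 1 - l : ℕ) : ℝ) + 1 = Fintype.card ι - l := by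
    rw [← Nat.cast_sub hl.le, ← h1]; push_cast; ring
  rw [h2, mul_comm] at h
  rw [h]
  refine Finset.sum_congr rfl fun i _ => ?_
  have hc : (Finset.univ.erase i).card = Fintype.card ι - 1 := by
    rw [Finset.card_erase_of_mem (Finset.mem_univ i), Finset.card_univ]
  rw [esym_eq_coeff lam _ (by omega), hc]

/-- Euler's identity for a homogeneous polynomial, obtained by summing S_l = λ_i ∂_i S_l + S_l(λ
without λ_i) over i. -/
theorem sum_esymDeriv_mul (l : ℕ) (hl : l ≤ Fintype.card ι) :
    ∑ i, esymDeriv lam i l * lam i = l * esym lam Finset.univ l := by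
  have h : ∑ i : ι, esym lam Finset.univ l
      = ∑ i, (lam i * esymDeriv lam i l + esym lam (Finset.univ.erase i) l) :=
    Finset.sum_congr rfl fun i _ => esym_eq_add_esymDeriv lam i l
  rw [Finset.sum_add_distrib, sum_esym_erase lam l hl, Finset.sum_const, Finset.card_univ,
    nsmul_eq_mul] at h
  simp only [mul_comm (esymDeriv lam _ l)]
  linarith

variable {k : ℕ}

/-- Euler's identity in degree one. It lets the linearized operator applied to `u` cancel the time
derivative of `u`. -/
theorem sum_quotDeriv_mul (hk : k < Fintype.card ι) (h0 : 0 < esym lam Finset.univ k) :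
    ∑ i, quotDeriv lam k i * lam i = esym lam Finset.univ (k + 1) / esym lam Finset.univ k := by
  have h1 := sum_esymDeriv_mul lam (k + 1) hk
  have h2 := sum_esymDeriv_mul lam k hk.le
  have : ∑ i, quotDeriv lam k i * lam i
      = ((∑ i, esymDeriv lam i (k + 1) * lam i) * esym lam Finset.univ k
        - esym lam Finset.univ (k + 1) * ∑ i, esymDeriv lam i k * lam i)
          / (esym lam Finset.univ k) ^ 2 := by
    rw [Finset.sum_mul, Finset.mul_sum, ← Finset.sum_sub_distrib, Finset.sum_div]
    refine Finset.sum_congr rfl fun i _ => ?_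
    rw [quotDeriv]; ring
  rw [this, h1, h2]
  push_cast
  field_simp
  ring

/-- After splitting off λ_i from S_k and S_{k+1} the terms containing λ_i cancel, so the numerator
is a Newton expression in the other variables only. -/
theorem quotDeriv_eq (i : ι) :
    quotDeriv lam k i = ((esym lam (Finset.univ.erase i) k) ^ 2
      - esymDeriv lam i k * esym lam (Finset.univ.erase i) (k + 1))
        / (esym lam Finset.univ k) ^ 2 := by
  rw [quotDeriv, esym_eq_add_esymDeriv lam i (k + 1)]
  congr 1
  rw [esym_eq_add_esymDeriv lam i k]
  simp only [esymDeriv]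
  ring

theorem le_quotDeriv (i : ι) :
    (esym lam (Finset.univ.erase i) k) ^ 2 / Fintype.card ι / (esym lam Finset.univ k) ^ 2
      ≤ quotDeriv lam k i := by
  rw [quotDeriv_eq]
  have hpos : 0 < Fintype.card ι := Fintype.card_pos_iff.2 ⟨i⟩
  have hc : (((Finset.univ.erase i).card : ℕ) : ℝ) + 1 = Fintype.card ι := by
    rw [Finset.card_erase_of_mem (Finset.mem_univ i), Finset.card_univ]
    exact_mod_cast Nat.sub_add_cancel hpos
  gcongr
  cases k with
  | zero =>
    simp only [esymDeriv, esym_zero, zero_mul, sub_zero]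
    exact div_le_self (by norm_num) (by exact_mod_cast hpos)
  | succ k =>
    have := esym_newton lam (Finset.univ.erase i) k
    rw [hc] at this
    exact this

theorem quotDeriv_nonneg (i : ι) : 0 ≤ quotDeriv lam k i :=
  le_trans (by positivity) (le_quotDeriv lam i)

variable {lam}

/-- In S_{k+1} = λ_i S_k(λ without λ_i) + S_{k+1}(λ without λ_i) the first term is nonpositive,
because by induction S_k without λ_i is at least S_k > 0. -/
theorem esym_erase_ge {i : ι} (hS : ∀ l ≤ k, 0 < esym lam Finset.univ l) (hi : lam i ≤ 0) :
    esym lam Finset.univ k ≤ esym lam (Finset.univ.erase i) k := by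
  induction k with
  | zero => simp [esym_zero]
  | succ k ih =>
    have h1 := ih fun l hl => hS l (by omega)
    have h2 := hS k (by omega)
    rw [esym_succ lam (Finset.mem_univ i)]
    nlinarith

theorem quotDeriv_ge_of_nonpos {i : ι} (hS : ∀ l ≤ k, 0 < esym lam Finset.univ l)
    (hi : lam i ≤ 0) : 1 / (Fintype.card ι : ℝ) ≤ quotDeriv lam k i := by
  refine le_trans ?_ (le_quotDeriv lam i)
  have h0 := hS k le_rfl
  have h1 := esym_erase_ge hS hi
  have hpos : (0 : ℝ) < Fintype.card ι := by exact_mod_cast Fintype.card_pos_iff.2 ⟨i⟩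
  rw [le_div_iff₀ (by positivity), div_mul_eq_mul_div, one_mul]
  gcongr

/-- The term carrying ∂_i S_k has a favourable sign in the cone, and ∑ ∂_i S_{k+1} = (n - k) S_k.
This controls the second derivatives of the cutoff |x|². -/
theorem sum_quotDeriv_le (hk : k < Fintype.card ι) (hS : ∀ l ≤ k + 1, 0 < esym lam Finset.univ l) :
    ∑ i, quotDeriv lam k i ≤ Fintype.card ι := by
  have h0 := hS k (by omega)
  have h1 := hS (k + 1) le_rfl
  have hnn : 0 ≤ ∑ i, esymDeriv lam i k := by
    cases k with
    | zero => simp [esymDeriv]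
    | succ k =>
      simp only [esymDeriv]
      rw [sum_esym_erase lam k (by omega)]
      have h2 := hS k (by omega)
      have : (k : ℝ) ≤ Fintype.card ι := by exact_mod_cast (by omega : k ≤ Fintype.card ι)
      exact mul_nonneg (by linarith) h2.le
  have : ∑ i, quotDeriv lam k i
      = ((∑ i, esym lam (Finset.univ.erase i) k) * esym lam Finset.univ k
        - esym lam Finset.univ (k + 1) * ∑ i, esymDeriv lam i k)
          / (esym lam Finset.univ k) ^ 2 := by
    rw [Finset.sum_mul, Finset.mul_sum, ← Finset.sum_sub_distrib, Finset.sum_div]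
    rfl
  rw [this, sum_esym_erase lam k hk.le, div_le_iff₀ (by positivity)]
  have hk0 : (0 : ℝ) ≤ k := Nat.cast_nonneg k
  nlinarith [mul_nonneg h1.le hnn, mul_nonneg hk0 (sq_nonneg (esym lam Finset.univ k))]

end Newton

/-! ### Elementary symmetric functions of the eigenvalues of a matrix -/

section matrixEsymm

variable {ι : Type*} [Fintype ι] [DecidableEq ι]

/-- The elementary symmetric function of degree `l` of the eigenvalues of a matrix (the sum of its
principal minors of size `l`), read off from the characteristic polynomial. -/
noncomputable def matrixEsymm (l : ℕ) (A : Matrix ι ι ℝ) : ℝ :=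
  (-A).charpoly.coeff (Fintype.card ι - l)

theorem matrixEsymm_mul_comm (l : ℕ) (A B : Matrix ι ι ℝ) :
    matrixEsymm l (A * B) = matrixEsymm l (B * A) := by
  rw [matrixEsymm, matrixEsymm, ← Matrix.neg_mul, Matrix.charpoly_mul_comm, Matrix.mul_neg]

theorem matrixEsymm_conj (l : ℕ) {S R : Matrix ι ι ℝ} (h : R * S = 1) (A : Matrix ι ι ℝ) :
    matrixEsymm l (S * A * R) = matrixEsymm l A := by
  rw [matrixEsymm_mul_comm, ← Matrix.mul_assoc, h, Matrix.one_mul]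

theorem matrixEsymm_diagonal {l : ℕ} (hl : l ≤ Fintype.card ι) (lam : ι → ℝ) :
    matrixEsymm l (Matrix.diagonal lam) = esym lam Finset.univ l := by
  rw [esym_eq_coeff lam Finset.univ hl, Finset.card_univ, matrixEsymm, Matrix.charpoly]
  congr 1
  rw [Matrix.charmatrix, Matrix.scalar_apply, RingHom.mapMatrix_apply, Matrix.diagonal_neg,
    Matrix.diagonal_map (map_zero _), Matrix.diagonal_sub, Matrix.det_diagonal]
  refine Finset.prod_congr rfl fun i _ => ?_
  simp

theorem matrixEsymm_eq_eval (l : ℕ) (A : ι → ι → ℝ) :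
    matrixEsymm l (Matrix.of A) = MvPolynomial.eval (fun ij : ι × ι => -A ij.1 ij.2)
      ((Matrix.charpoly.univ ℝ ι).coeff (Fintype.card ι - l)) := by
  have h := Matrix.charpoly.univ_coeff_eval₂Hom ι (RingHom.id ℝ)
    (fun ij : ι × ι => -A ij.1 ij.2) (Fintype.card ι - l)
  exact h.symm

theorem MvPolynomial.contDiff_eval {σ : Type*} [Fintype σ] (p : MvPolynomial σ ℝ)
    {m : WithTop ℕ∞} : ContDiff ℝ m fun x : σ → ℝ => MvPolynomial.eval x p := by
  induction p using MvPolynomial.induction_on with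
  | C a => simpa using contDiff_const
  | add p q hp hq => simpa using hp.add hq
  | mul_X p i hp => simpa using hp.mul (contDiff_apply ℝ ℝ i)

theorem contDiff_matrixEsymm (l : ℕ) {m : WithTop ℕ∞} :
    ContDiff ℝ m fun A : ι → ι → ℝ => matrixEsymm l (Matrix.of A) := by
  simp only [matrixEsymm_eq_eval]
  refine (MvPolynomial.contDiff_eval _).comp (contDiff_pi.2 fun ij => ?_)
  fun_prop

/-- The coefficients of the universal characteristic polynomial are homogeneous in the matrix
entries. -/
theorem matrixEsymm_smul {l : ℕ} (hl : l ≤ Fintype.card ι) (c : ℝ) (A : Matrix ι ι ℝ) :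
    matrixEsymm l (c • A) = c ^ l * matrixEsymm l A := by
  have h := Matrix.charpoly.univ_coeff_isHomogeneous ℝ ι (Fintype.card ι - l) l (by omega)
  have h1 := matrixEsymm_eq_eval l (fun i j => (c • A) i j)
  have h2 := matrixEsymm_eq_eval l (fun i j => A i j)
  have e : (fun ij : ι × ι => -(c • A) ij.1 ij.2) = c • fun ij : ι × ι => -A ij.1 ij.2 := by
    ext ij; simp
  refine h1.trans ?_
  rw [e]
  refine Eq.trans ?_ (congrArg (c ^ l * ·) h2).symm
  simp only [MvPolynomial.eval_eq', Finset.mul_sum]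
  refine Finset.sum_congr rfl fun d hd => ?_
  have hdeg := h (MvPolynomial.mem_support_iff.1 hd)
  simp only [Pi.smul_apply, smul_eq_mul, mul_pow, Finset.prod_mul_distrib, Finset.prod_pow_eq_pow_sum]
  have : ∑ i, d i = l := by
    rw [← hdeg, Finsupp.weight_apply, Finsupp.sum_fintype] <;> simp
  rw [this]; ring

theorem Equiv.Perm.eq_one_of_forall_ne {ι : Type*} {σ : Equiv.Perm ι} (i : ι)
    (h : ∀ j, j ≠ i → σ j = j) : σ = 1 := by
  ext j
  rcases eq_or_ne j i with hj | hj
  · subst hj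
    by_contra hne
    exact hne (σ.injective (h _ hne))
  · exact h j hj

/-- In the Leibniz formula a permutation other than the identity moves at least two indices.
Differentiating one factor therefore leaves a vanishing off-diagonal entry in the product. -/
theorem hasDerivAt_det_of_diagonal {N : ℝ → Matrix ι ι ℝ} {N' : Matrix ι ι ℝ} {d : ι → ℝ} {x : ℝ}
    (hN : ∀ i j, HasDerivAt (fun s => N s i j) (N' i j) x) (hd : N x = Matrix.diagonal d) :
    HasDerivAt (fun s => (N s).det) (∑ i, N' i i * ∏ j ∈ Finset.univ.erase i, d j) x := by
  simp only [Matrix.det_apply']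
  have h : ∀ σ : Equiv.Perm ι, HasDerivAt (fun s => ((Equiv.Perm.sign σ : ℤ) : ℝ) * ∏ i, N s (σ i) i)
      (if σ = 1 then ∑ i, N' i i * ∏ j ∈ Finset.univ.erase i, d j else 0) x := by
    intro σ
    have h1 := (HasDerivAt.fun_finsetProd (u := Finset.univ) fun i _ => hN (σ i) i).const_mul
      (((Equiv.Perm.sign σ : ℤ) : ℝ))
    refine h1.congr_deriv ?_
    symm
    split_ifs with hσ
    · subst hσ
      simp only [Equiv.Perm.sign_one, Units.val_one, Int.cast_one, one_mul, Equiv.Perm.one_apply,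
        smul_eq_mul, hd, Matrix.diagonal_apply_eq]
      exact Finset.sum_congr rfl fun i _ => mul_comm _ _
    · symm
      refine mul_eq_zero_of_right _ (Finset.sum_eq_zero fun i _ => ?_)
      obtain ⟨j, hji, hj⟩ : ∃ j, j ≠ i ∧ σ j ≠ j := by
        by_contra! hcon
        exact hσ (Equiv.Perm.eq_one_of_forall_ne i hcon)
      rw [Finset.prod_eq_zero (i := j) (by simp [hji]), zero_smul]
      rw [hd, Matrix.diagonal_apply_ne _ hj]
  have h2 := HasDerivAt.fun_sum (u := Finset.univ) fun σ _ => h σ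
  exact h2.congr_deriv (by simp)

/-- Differentiate det(t + N(s)) for every t, once coefficient by coefficient and once by the
determinant formula at a diagonal matrix. The results agree as polynomials in t, so their
coefficients agree. No perturbation theory of eigenvalues is needed. -/
theorem hasDerivAt_matrixEsymm_of_diagonal {N : ℝ → Matrix ι ι ℝ} {N' : Matrix ι ι ℝ}
    {lam : ι → ℝ} {x : ℝ} (hN : ∀ i j, HasDerivAt (fun s => N s i j) (N' i j) x)
    (hd : N x = Matrix.diagonal lam) {l : ℕ} (hl : l ≤ Fintype.card ι) :
    HasDerivAt (fun s => matrixEsymm l (N s)) (∑ i, N' i i * esymDeriv lam i l) x := by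
  have hdiff : ∀ j : ℕ, DifferentiableAt ℝ (fun s => (-(N s)).charpoly.coeff j) x := by
    intro j
    rcases le_or_gt j (Fintype.card ι) with hj | hj
    · have h1 : DifferentiableAt ℝ (fun s => matrixEsymm (Fintype.card ι - j) (N s)) x := by
        have h2 : DifferentiableAt ℝ (fun s => (fun i j => N s i j : ι → ι → ℝ)) x :=
          differentiableAt_pi.2 fun i => differentiableAt_pi.2 fun j => (hN i j).differentiableAt
        exact ((contDiff_matrixEsymm (ι := ι) (Fintype.card ι - j) (m := 1)).differentiable
          one_ne_zero _).comp x h2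
      simpa only [matrixEsymm, Nat.sub_sub_self hj] using h1
    · have : (fun s => (-(N s)).charpoly.coeff j) = fun _ => 0 := by
        ext s
        exact Polynomial.coeff_eq_zero_of_natDegree_lt (by rwa [Matrix.charpoly_natDegree_eq_dim])
      rw [this]; exact differentiableAt_const _
  set q : Polynomial ℝ := ∑ j ∈ Finset.range (Fintype.card ι + 1),
    Polynomial.monomial j (deriv (fun s => (-(N s)).charpoly.coeff j) x) with hq
  set q' : Polynomial ℝ := ∑ i, Polynomial.C (N' i i) *
    ∏ j ∈ Finset.univ.erase i, (Polynomial.X + Polynomial.C (lam j)) with hq'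
  have hqq : q = q' := by
    refine Polynomial.funext fun t => ?_
    have h1 : HasDerivAt (fun s => (-(N s)).charpoly.eval t) (q.eval t) x := by
      have : (fun s => (-(N s)).charpoly.eval t) = fun s =>
          ∑ j ∈ Finset.range (Fintype.card ι + 1), (-(N s)).charpoly.coeff j * t ^ j := by
        ext s
        rw [Polynomial.eval_eq_sum_range, Matrix.charpoly_natDegree_eq_dim]
      rw [this, hq, Polynomial.eval_finsetSum]
      refine HasDerivAt.fun_sum fun j _ => ?_
      rw [Polynomial.eval_monomial]
      exact (hdiff j).hasDerivAt.mul_const _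
    have h2 : HasDerivAt (fun s => (-(N s)).charpoly.eval t) (q'.eval t) x := by
      have : (fun s => (-(N s)).charpoly.eval t) = fun s => (Matrix.scalar ι t + N s).det := by
        ext s
        rw [Matrix.eval_charpoly, sub_neg_eq_add]
      rw [this, hq', Polynomial.eval_finsetSum]
      have h3 := hasDerivAt_det_of_diagonal (N := fun s => Matrix.scalar ι t + N s) (N' := N')
        (d := fun i => t + lam i) (x := x)
        (fun i j => (hN i j).const_add _) (by
          simp only [hd, Matrix.scalar_apply, Matrix.diagonal_add])
      refine h3.congr_deriv ?_
      refine Finset.sum_congr rfl fun i _ => ?_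
      simp [Polynomial.eval_prod]
    exact h1.unique h2
  have hc := congrArg (fun p : Polynomial ℝ => p.coeff (Fintype.card ι - l)) hqq
  have hval : deriv (fun s => (-(N s)).charpoly.coeff (Fintype.card ι - l)) x
      = ∑ i, N' i i * esymDeriv lam i l := by
    simp only [hq, hq', Polynomial.finsetSum_coeff, Polynomial.coeff_monomial,
      Polynomial.coeff_C_mul, Finset.sum_ite_eq', Finset.mem_range] at hc
    rw [if_pos (by omega)] at hc
    rw [hc]
    refine Finset.sum_congr rfl fun i _ => ?_
    congr 1
    have hpos : 0 < Fintype.card ι := Fintype.card_pos_iff.2 ⟨i⟩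
    have hcard : (Finset.univ.erase i).card = Fintype.card ι - 1 := by
      rw [Finset.card_erase_of_mem (Finset.mem_univ i), Finset.card_univ]
    cases l with
    | zero =>
      refine Polynomial.coeff_eq_zero_of_natDegree_lt ?_
      rw [Polynomial.natDegree_prod_of_monic _ _ fun j _ => Polynomial.monic_X_add_C _]
      simp only [Polynomial.natDegree_X_add_C, Finset.sum_const, hcard, smul_eq_mul]
      omega
    | succ l =>
      rw [esymDeriv, esym_eq_coeff lam _ (by omega), hcard]
      congr 1; omega
  rw [← hval]
  exact (hdiff _).hasDerivAt

/-- The derivative of the curvature quotient along a curve of matrices through a diagonal one. -/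
theorem hasDerivAt_matrixEsymm_div_of_diagonal {N : ℝ → Matrix ι ι ℝ} {N' : Matrix ι ι ℝ}
    {lam : ι → ℝ} {x : ℝ} (hN : ∀ i j, HasDerivAt (fun s => N s i j) (N' i j) x)
    (hd : N x = Matrix.diagonal lam) {k : ℕ} (hk : k < Fintype.card ι)
    (h0 : esym lam Finset.univ k ≠ 0) :
    HasDerivAt (fun s => matrixEsymm (k + 1) (N s) / matrixEsymm k (N s))
      (∑ i, N' i i * quotDeriv lam k i) x := by
  have h1 := hasDerivAt_matrixEsymm_of_diagonal hN hd (l := k + 1) hk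
  have h2 := hasDerivAt_matrixEsymm_of_diagonal hN hd hk.le
  have e0 : matrixEsymm k (N x) = esym lam Finset.univ k := by
    rw [hd, matrixEsymm_diagonal hk.le]
  have e1 : matrixEsymm (k + 1) (N x) = esym lam Finset.univ (k + 1) := by
    rw [hd, matrixEsymm_diagonal hk]
  have h3 := h1.div h2 (by rw [e0]; exact h0)
  refine h3.congr_deriv ?_
  rw [e0, e1, Finset.sum_mul, Finset.mul_sum, ← Finset.sum_sub_distrib, Finset.sum_div]
  refine Finset.sum_congr rfl fun i _ => ?_
  rw [quotDeriv]; ring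

end matrixEsymm

/-! ### The metric of a graph and its Weingarten matrix -/

section graphMetric

open Matrix

variable {ι : Type*} [Fintype ι]

theorem one_add_dotProduct_self_pos (p : ι → ℝ) : 0 < 1 + p ⬝ᵥ p := by
  have : 0 ≤ p ⬝ᵥ p := Finset.sum_nonneg fun i _ => mul_self_nonneg _
  linarith

theorem vecMulVec_self_mul_self (p : ι → ℝ) :
    vecMulVec p p * vecMulVec p p = (p ⬝ᵥ p) • vecMulVec p p := by
  rw [vecMulVec_mul_vecMulVec, vecMulVec_smul]

variable [DecidableEq ι]

/-- The first fundamental form of a graph with gradient `p`. -/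
def graphMetric (p : ι → ℝ) : Matrix ι ι ℝ := 1 + vecMulVec p p

/-- The inverse of the first fundamental form of a graph with gradient `p`. -/
noncomputable def graphCometric (p : ι → ℝ) : Matrix ι ι ℝ :=
  1 - (1 + p ⬝ᵥ p)⁻¹ • vecMulVec p p

/-- The positive square root of `graphCometric p`. -/
noncomputable def graphCometricRoot (p : ι → ℝ) : Matrix ι ι ℝ :=
  1 - (√(1 + p ⬝ᵥ p) * (1 + √(1 + p ⬝ᵥ p)))⁻¹ • vecMulVec p p

theorem graphMetric_mul_graphCometric (p : ι → ℝ) : graphMetric p * graphCometric p = 1 := by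
  have h := (one_add_dotProduct_self_pos p).ne'
  rw [graphMetric, graphCometric, mul_sub, mul_one, add_mul, one_mul, Matrix.mul_smul,
    vecMulVec_self_mul_self, smul_smul, ← add_smul,
    ← mul_one_add, inv_mul_cancel₀ h, one_smul, add_sub_cancel_right]

theorem graphCometricRoot_mul_self (p : ι → ℝ) :
    graphCometricRoot p * graphCometricRoot p = graphCometric p := by
  have h := one_add_dotProduct_self_pos p
  have hw : 0 < √(1 + p ⬝ᵥ p) := Real.sqrt_pos.2 h
  have hw2 : √(1 + p ⬝ᵥ p) ^ 2 = 1 + p ⬝ᵥ p := Real.sq_sqrt h.le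
  rw [graphCometricRoot, graphCometric]
  generalize √(1 + p ⬝ᵥ p) = w at hw hw2
  have hp : p ⬝ᵥ p = w ^ 2 - 1 := by linarith
  rw [mul_sub, mul_one, sub_mul, one_mul, Matrix.smul_mul, Matrix.mul_smul,
    vecMulVec_self_mul_self, hp, smul_smul, smul_smul, sub_sub, ← sub_smul, ← add_smul]
  congr 2
  field_simp
  ring

theorem graphCometricRoot_transpose (p : ι → ℝ) :
    (graphCometricRoot p)ᵀ = graphCometricRoot p := by
  simp [graphCometricRoot, transpose_vecMulVec]

theorem graphCometricRoot_mul_graphMetric (p : ι → ℝ) :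
    graphCometricRoot p * graphMetric p * graphCometricRoot p = 1 := by
  have h : graphMetric p * graphCometricRoot p = graphCometricRoot p * graphMetric p := by
    simp only [graphMetric, graphCometricRoot, mul_sub, sub_mul, mul_add, add_mul, mul_one, one_mul,
      Matrix.mul_smul, Matrix.smul_mul]
    abel
  rw [mul_assoc, h, ← mul_assoc, graphCometricRoot_mul_self]
  exact mul_eq_one_comm.1 (graphMetric_mul_graphCometric p)

/-- Simultaneous diagonalization of the first fundamental form and of the Hessian of a graph. -/
theorem exists_principal_frame (p : ι → ℝ) {H : Matrix ι ι ℝ} (hH : H.IsHermitian) :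
    ∃ (R : Matrix ι ι ℝ) (lam : ι → ℝ),
      Rᵀ * graphMetric p * R = 1 ∧ Rᵀ * H * R = diagonal lam := by
  set P := graphCometricRoot p
  have hP : Pᵀ = P := graphCometricRoot_transpose p
  have hH' : Hᵀ = H := hH
  have hA : (P * H * P).IsHermitian := by
    change (P * H * P)ᵀ = _
    rw [transpose_mul, transpose_mul, hP, hH', mul_assoc]
  set U : Matrix ι ι ℝ := (hA.eigenvectorUnitary : Matrix ι ι ℝ) with hU
  have hUU : Uᵀ * U = 1 := (Matrix.mem_unitaryGroup_iff').1 hA.eigenvectorUnitary.2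
  have hs : P * H * P = U * diagonal hA.eigenvalues * Uᵀ := by
    have := hA.spectral_theorem
    rw [Unitary.conjStarAlgAut_apply] at this
    exact this
  -- `P` is the square root of g⁻¹, so P g P = 1, and the orthogonal `U` diagonalizes P H P.
  refine ⟨P * U, hA.eigenvalues, ?_, ?_⟩
  · rw [transpose_mul, hP]
    calc Uᵀ * P * graphMetric p * (P * U) = Uᵀ * (P * graphMetric p * P) * U := by
          simp only [mul_assoc]
      _ = 1 := by rw [graphCometricRoot_mul_graphMetric, mul_one, hUU]
  · rw [transpose_mul, hP]
    calc Uᵀ * P * H * (P * U) = Uᵀ * (P * H * P) * U := by simp only [mul_assoc]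
      _ = (Uᵀ * U) * diagonal hA.eigenvalues * (Uᵀ * U) := by
          conv_lhs => rw [hs]
          simp only [mul_assoc]
      _ = _ := by rw [hUU, one_mul, mul_one]

section frame

variable {p : ι → ℝ} {R : Matrix ι ι ℝ}

theorem frame_mul_coframe (h : Rᵀ * graphMetric p * R = 1) : R * (Rᵀ * graphMetric p) = 1 :=
  mul_eq_one_comm.1 h

theorem frame_mul_transpose (h : Rᵀ * graphMetric p * R = 1) : R * Rᵀ = graphCometric p := by
  have h1 := frame_mul_coframe h
  calc R * Rᵀ = R * Rᵀ * (graphMetric p * graphCometric p) := by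
        rw [graphMetric_mul_graphCometric, mul_one]
    _ = (R * (Rᵀ * graphMetric p)) * graphCometric p := by simp only [mul_assoc]
    _ = _ := by rw [h1, one_mul]

theorem coframe_mul_cometric (M : Matrix ι ι ℝ) :
    Rᵀ * graphMetric p * (graphCometric p * M) * R = Rᵀ * M * R := by
  calc Rᵀ * graphMetric p * (graphCometric p * M) * R
      = Rᵀ * (graphMetric p * graphCometric p) * M * R := by simp only [mul_assoc]
    _ = _ := by rw [graphMetric_mul_graphCometric, mul_one]

end frame

theorem matrixEsymm_eq_esymm_roots {A : Matrix ι ι ℝ} (hA : A.IsHermitian) {l : ℕ}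
    (hl : l ≤ Fintype.card ι) : A.charpoly.roots.esymm l = matrixEsymm l A := by
  have h1 : A.charpoly.roots = Finset.univ.val.map hA.eigenvalues := by
    simpa using hA.roots_charpoly_eq_eigenvalues
  rw [h1, esym_eq_multiset_esymm, ← matrixEsymm_diagonal hl]
  have := hA.spectral_theorem
  rw [Unitary.conjStarAlgAut_apply] at this
  conv_rhs => rw [this]
  symm
  exact matrixEsymm_conj l ((Matrix.mem_unitaryGroup_iff').1 hA.eigenvectorUnitary.2) _

end graphMetric

/-! ### Curvature functions of a graph in terms of g⁻¹ D²f -/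

section weingarten

open Matrix

variable {n : ℕ} {f : EuclideanSpace ℝ (Fin n) → ℝ} {x : EuclideanSpace ℝ (Fin n)}

theorem slopeFactor_eq : slopeFactor f x = √(1 + (gradient f x).ofLp ⬝ᵥ (gradient f x).ofLp) := by
  rw [slopeFactor, EuclideanSpace.real_norm_sq_eq]
  simp [dotProduct, sq]

theorem slopeFactor_pos : 0 < slopeFactor f x := Real.sqrt_pos.2 (by positivity)

theorem weingartenMatrix_eq (hH : (hessianMatrix f x).IsHermitian) :
    weingartenMatrix f x = (slopeFactor f x)⁻¹ • (graphCometricRoot (gradient f x).ofLp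
      * hessianMatrix f x * graphCometricRoot (gradient f x).ofLp) := by
  have hsym : ∀ i j, hessianMatrix f x i j = hessianMatrix f x j i := fun i j => by
    conv_lhs => rw [← hH]
    simp
  ext i j
  rw [weingartenMatrix, graphCometricRoot, ← slopeFactor_eq]
  have hw := slopeFactor_pos (f := f) (x := x)
  generalize hessianMatrix f x = H at *
  generalize slopeFactor f x = w at *
  generalize gradient f x = p at *
  simp only [of_apply, Matrix.smul_apply, smul_eq_mul]
  congr 1
  set c := (w * (1 + w))⁻¹ with hc
  have h1 : ∀ i j, (vecMulVec p.ofLp p.ofLp * H) i j = ∑ k, p i * p k * H k j := by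
    intro i j; simp [mul_apply, vecMulVec_apply]
  have h2 : ∀ i j, (H * vecMulVec p.ofLp p.ofLp) i j = ∑ k, p j * p k * H k i := by
    intro i j
    simp only [mul_apply, vecMulVec_apply]
    exact Finset.sum_congr rfl fun k _ => by rw [hsym i k]; ring
  have h3 : (vecMulVec p.ofLp p.ofLp * H * vecMulVec p.ofLp p.ofLp) i j
      = ∑ k, ∑ l, p i * p j * p k * p l * H k l := by
    simp only [mul_apply, vecMulVec_apply, Finset.sum_mul]
    rw [Finset.sum_comm]
    refine Finset.sum_congr rfl fun k _ => Finset.sum_congr rfl fun l _ => by ring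
  have : (1 - c • vecMulVec p.ofLp p.ofLp) * H * (1 - c • vecMulVec p.ofLp p.ofLp)
      = H - c • (vecMulVec p.ofLp p.ofLp * H) - c • (H * vecMulVec p.ofLp p.ofLp)
        + c ^ 2 • (vecMulVec p.ofLp p.ofLp * H * vecMulVec p.ofLp p.ofLp) := by
    simp only [sub_mul, mul_sub, one_mul, mul_one, Matrix.smul_mul, Matrix.mul_smul,
      smul_smul, sq]
    abel
  rw [this]
  simp only [Matrix.add_apply, Matrix.sub_apply, Matrix.smul_apply, smul_eq_mul, h1, h2, h3]
  rw [hc]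
  field_simp

variable (f x) in
/-- The graphical shape operator `g⁻¹ D²f`, without normalization by the slope factor. -/
noncomputable def cometricHessian : Matrix (Fin n) (Fin n) ℝ :=
  graphCometric (gradient f x).ofLp * hessianMatrix f x

/-- The Weingarten matrix is w⁻¹ P H P with P² = g⁻¹, and P H P has the characteristic polynomial of
g⁻¹ H. The square root thus disappears, and what is left is easy to differentiate. -/
theorem esymm_principalCurvatures (hH : (hessianMatrix f x).IsHermitian) {l : ℕ} (hl : l ≤ n) :
    (principalCurvatures f x).esymm l
      = (slopeFactor f x)⁻¹ ^ l * matrixEsymm l (cometricHessian f x) := by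
  have hl' : l ≤ Fintype.card (Fin n) := by simpa using hl
  have hA : (weingartenMatrix f x).IsHermitian := by
    rw [weingartenMatrix_eq hH]
    have hH' : (hessianMatrix f x)ᵀ = hessianMatrix f x := hH
    rw [IsHermitian, conjTranspose_eq_transpose_of_trivial, transpose_smul, transpose_mul,
      transpose_mul, graphCometricRoot_transpose, hH', mul_assoc]
  rw [principalCurvatures, matrixEsymm_eq_esymm_roots hA hl', weingartenMatrix_eq hH,
    matrixEsymm_smul hl', mul_assoc, matrixEsymm_mul_comm, mul_assoc, graphCometricRoot_mul_self,
    matrixEsymm_mul_comm, cometricHessian]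

/-- The quotient has degree one, so its factor w⁻¹ cancels the factor w in the equation and the flow
becomes u_t = Q(g⁻¹ D²u). -/
theorem curvatureQuotient_mul_slopeFactor (hH : (hessianMatrix f x).IsHermitian) {k : ℕ}
    (hk : k < n) :
    curvatureQuotient k (principalCurvatures f x) * slopeFactor f x
      = matrixEsymm (k + 1) (cometricHessian f x) / matrixEsymm k (cometricHessian f x) := by
  have hw := slopeFactor_pos (f := f) (x := x)
  rw [curvatureQuotient, esymm_principalCurvatures hH hk, esymm_principalCurvatures hH hk.le,
    pow_succ, mul_assoc, mul_div_mul_left _ _ (by positivity)]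
  field_simp

theorem matrixEsymm_cometricHessian_pos (hH : (hessianMatrix f x).IsHermitian) {k : ℕ}
    (hk : k < n) (h : principalCurvatures f x ∈ gammaCone (k + 1)) {l : ℕ} (hl : l ≤ k + 1) :
    0 < matrixEsymm l (cometricHessian f x) := by
  have h1 := h l hl
  rw [esymm_principalCurvatures hH (by omega)] at h1
  exact pos_of_mul_pos_right h1 (pow_nonneg (inv_nonneg.2 slopeFactor_pos.le) _)

end weingarten

/-! ### Calculus lemmas -/

section calculus

open Filter Topology

/-- The necessary second order condition at a local maximum. -/
theorem IsLocalMax.hasDerivAt_hasDerivAt_nonpos {f f' : ℝ → ℝ} {f'' x : ℝ} (h : IsLocalMax f x)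
    (hf : ∀ᶠ s in 𝓝 x, HasDerivAt f (f' s) s) (hf' : HasDerivAt f' f'' x) : f'' ≤ 0 := by
  have hd : deriv f =ᶠ[𝓝 x] f' := hf.mono fun s hs => hs.deriv
  have hdd : deriv (deriv f) x = f'' := hd.deriv_eq.trans hf'.deriv
  by_contra! hpos
  -- A positive second derivative would make the maximum point also a local minimum. Then `f` would
  -- be locally constant, with vanishing second derivative.
  have hmin : IsLocalMin f x :=
    isLocalMin_of_deriv_deriv_pos (by rwa [hdd]) h.deriv_eq_zero hf.self_of_nhds.continuousAt
  have hconst : f =ᶠ[𝓝 x] fun _ => f x := by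
    filter_upwards [h, hmin] with s h1 h2 using le_antisymm h1 h2
  have h0 : deriv f =ᶠ[𝓝 x] fun _ => 0 := by
    filter_upwards [hconst.eventuallyEq_nhds] with s hs
    rw [hs.deriv_eq, deriv_const]
  rw [← hdd, h0.deriv_eq, deriv_const] at hpos
  exact lt_irrefl _ hpos

/-- Symmetry of mixed derivatives: if `∂ₜ h = g` on a time interval `I` and `∂ₛ g` is continuous,
then `∂ₛ h` is differentiable in time with derivative `∂ₛ g`. -/
theorem hasDerivWithinAt_of_mixed {I : Set ℝ} (hI : Convex ℝ I) {ρ t₀ : ℝ} (hρ : 0 < ρ)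
    (ht₀ : t₀ ∈ I) {h g gs : ℝ → ℝ → ℝ} {v : ℝ → ℝ}
    (hh : ∀ s ∈ Metric.ball (0 : ℝ) ρ, ∀ t ∈ I, HasDerivWithinAt (h s) (g s t) I t)
    (hg : ∀ s ∈ Metric.ball (0 : ℝ) ρ, ∀ t ∈ I, HasDerivAt (fun s => g s t) (gs s t) s)
    (hcont : ContinuousWithinAt (fun z : ℝ × ℝ => gs z.1 z.2) (Metric.ball 0 ρ ×ˢ I) (0, t₀))
    (hv : ∀ t ∈ I, HasDerivAt (fun s => h s t) (v t) 0) :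
    HasDerivWithinAt v (gs 0 t₀) I t₀ := by
  rw [hasDerivWithinAt_iff_isLittleO, Asymptotics.isLittleO_iff]
  intro ε hε
  obtain ⟨δ₀, hδ₀, hδ⟩ := Metric.continuousWithinAt_iff.1 hcont ε hε
  set δ := min δ₀ ρ with hδdef
  have hδpos : 0 < δ := lt_min hδ₀ hρ
  set γ := gs 0 t₀
  have hclose : ∀ s ∈ Metric.ball (0 : ℝ) δ, ∀ t ∈ I ∩ Metric.ball t₀ δ, ‖gs s t - γ‖ ≤ ε := by
    intro s hs t ht
    have hlt : dist (s, t) ((0 : ℝ), t₀) < δ₀ := by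
      rw [Prod.dist_eq]
      exact max_lt (lt_of_lt_of_le hs (min_le_left _ _)) (lt_of_lt_of_le ht.2 (min_le_left _ _))
    have := hδ (x := (s, t)) ⟨Metric.ball_subset_ball (min_le_right _ _) hs, ht.1⟩ hlt
    rw [Real.dist_eq] at this
    exact this.le
  have hsub : Metric.ball (0 : ℝ) δ ⊆ Metric.ball 0 ρ := Metric.ball_subset_ball (min_le_right _ _)
  have h0 : (0 : ℝ) ∈ Metric.ball (0 : ℝ) δ := Metric.mem_ball_self hδpos
  -- The mean value inequality is used in `s` here and in `t` for `hlip`; the resulting Lipschitz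
  -- bound in `s` passes to the derivative at s = 0.
  have hgdiff : ∀ s ∈ Metric.ball (0 : ℝ) δ, ∀ t ∈ I ∩ Metric.ball t₀ δ,
      ‖g s t - g 0 t - s * γ‖ ≤ ε * ‖s‖ := by
    intro s hs t ht
    have := (convex_ball (0 : ℝ) δ).norm_image_sub_le_of_norm_hasDerivWithin_le
      (f := fun s => g s t - s * γ) (f' := fun s => gs s t - 1 * γ) (C := ε)
      (fun s hs => ((hg s (hsub hs) t ht.1).sub ((hasDerivAt_id s).mul_const γ)).hasDerivWithinAt)
      (fun s hs => by simpa using hclose s hs t ht) h0 hs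
    simpa [sub_right_comm] using this
  filter_upwards [inter_mem_nhdsWithin I (Metric.ball_mem_nhds t₀ hδpos)] with t ht
  have ht0' : t₀ ∈ I ∩ Metric.ball t₀ δ := ⟨ht₀, Metric.mem_ball_self hδpos⟩
  have hlip : ∀ s ∈ Metric.ball (0 : ℝ) δ,
      ‖(h s t - h s t₀ - s * γ * (t - t₀)) - (h 0 t - h 0 t₀ - 0 * γ * (t - t₀))‖
        ≤ (ε * ‖t - t₀‖) * ‖s - 0‖ := by
    intro s hs
    have := (hI.inter (convex_ball t₀ δ)).norm_image_sub_le_of_norm_hasDerivWithin_le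
      (f := fun τ => h s τ - h 0 τ - τ * (s * γ)) (f' := fun τ => g s τ - g 0 τ - 1 * (s * γ))
      (C := ε * ‖s‖)
      (fun τ hτ => ((((hh s (hsub hs) τ hτ.1).sub (hh 0 (hsub h0) τ hτ.1)).sub
        ((hasDerivWithinAt_id τ I).mul_const (s * γ)))).mono inter_subset_left)
      (fun τ hτ => by simpa using hgdiff s hs τ hτ) ht0' ht
    calc _ = ‖(h s t - h 0 t - t * (s * γ)) - (h s t₀ - h 0 t₀ - t₀ * (s * γ))‖ := by
          congr 1; ring
      _ ≤ _ := this
      _ = _ := by rw [sub_zero]; ring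
  have hder : HasDerivAt (fun s => h s t - h s t₀ - s * γ * (t - t₀))
      (v t - v t₀ - 1 * γ * (t - t₀)) 0 :=
    ((hv t ht.1).sub (hv t₀ ht₀)).sub (((hasDerivAt_id (0 : ℝ)).mul_const γ).mul_const (t - t₀))
  have := hder.le_of_lip' (by positivity)
    (Filter.mem_of_superset (Metric.ball_mem_nhds 0 hδpos) hlip)
  simpa [mul_comm] using this

end calculus

/-! ### Pointwise algebra of the maximum principle -/

section pointwise

variable {ι : Type*} [Fintype ι]

/-- The algebra of the maximum principle for the product `η V`, `η = exp (C φ) - 1`, in a principal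
frame: `a` are the coefficients of the linearized operator, `lam` the eigenvalues, `p` the
components of the gradient, and `φ₁, φ₂, V₁, V₂` the first and second derivatives of `φ` and `V` in
the directions of the frame. -/
theorem maximum_principle_inequality {a lam p φ₁ φ₂ V₁ V₂ : ι → ℝ} {C η E V φt Vt c β : ℝ}
    (ha : ∀ i, 0 ≤ a i) (hac : ∀ i, lam i ≤ 0 → c ≤ a i) (hc : 0 ≤ c)
    (hC : 0 < C) (hE : 0 < E) (hη : 0 < η) (hV : 0 < V)
    (hfirst : ∀ i, C * φ₁ i * E * V + η * V₁ i = 0)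
    (hsecond : ∀ i, (C * φ₂ i + (C * φ₁ i) ^ 2) * E * V + 2 * (C * φ₁ i * E * V₁ i)
      + η * V₂ i ≤ 0)
    (hV₁ : ∀ i, V₁ i = V * (lam i * p i))
    (hVt : Vt = ∑ i, a i * (V₂ i - 2 / V * V₁ i ^ 2))
    (htime : 0 ≤ C * φt * E * V + η * Vt)
    (hp : ∑ i, p i ^ 2 ≤ 1) (hβ : 0 ≤ β) (hβφ : β ≤ ∑ i, p i * φ₁ i) :
    ∑ i, a i * φ₂ i + C * (c * β ^ 2) ≤ φt := by
  have hCE : 0 < C * E * V := by positivity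
  have h1 : ∀ i, η * (V₂ i - 2 / V * V₁ i ^ 2) ≤ -(C * E * V) * (φ₂ i + C * φ₁ i ^ 2) := by
    intro i
    have hf : η * V₁ i = -(C * φ₁ i * E * V) := by linarith [hfirst i]
    -- The quadratic term of the evolution of `V` equals the cross term of the second order
    -- condition, so no gradient term of `V` survives.
    have e1 : η * (2 / V * V₁ i ^ 2) = -2 * (C * φ₁ i * E * V₁ i) := by
      calc η * (2 / V * V₁ i ^ 2) = (η * V₁ i) * (2 / V * V₁ i) := by ring
        _ = _ := by rw [hf]; field_simp
    rw [mul_sub, e1]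
    linarith [hsecond i]
  have h2 : η * Vt ≤ -(C * E * V) * ∑ i, a i * (φ₂ i + C * φ₁ i ^ 2) := by
    rw [hVt, Finset.mul_sum, Finset.mul_sum]
    refine Finset.sum_le_sum fun i _ => ?_
    have := mul_le_mul_of_nonneg_left (h1 i) (ha i)
    linarith
  have h3 : ∑ i, a i * (φ₂ i + C * φ₁ i ^ 2) ≤ φt := by
    have : 0 ≤ (C * E * V) * (φt - ∑ i, a i * (φ₂ i + C * φ₁ i ^ 2)) := by linarith
    linarith [nonneg_of_mul_nonneg_right this hCE]
  have h4 : c * β ^ 2 ≤ ∑ i, a i * φ₁ i ^ 2 := by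
    set κ := η / (C * E) with hκ
    have hκ0 : 0 < κ := by positivity
    have hφ : ∀ i, φ₁ i = -κ * (lam i * p i) := by
      intro i
      have := hfirst i
      rw [hV₁ i] at this
      have h5 : (C * φ₁ i * E + η * (lam i * p i)) * V = 0 := by linarith
      have h6 := (mul_eq_zero.1 h5).resolve_right hV.ne'
      rw [hκ]; field_simp; linarith
    -- Since φ₁ i = -κ λ_i p_i, indices with λ_i > 0 contribute nonpositively to ∑ p_i φ₁ i and can
    -- be dropped; on the others a_i ≥ c.
    set μ : ι → ℝ := fun i => if lam i ≤ 0 then -κ * lam i else 0 with hμ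
    have h7 : ∑ i, p i * φ₁ i ≤ ∑ i, p i * (μ i * p i) := by
      refine Finset.sum_le_sum fun i _ => ?_
      rw [hφ i, hμ]
      dsimp only
      split_ifs with h
      · exact le_of_eq (by ring)
      · nlinarith [mul_nonneg (mul_nonneg hκ0.le (not_le.1 h).le) (sq_nonneg (p i))]
    have h8 : (∑ i, p i * (μ i * p i)) ^ 2 ≤ (∑ i, p i ^ 2) * ∑ i, (μ i * p i) ^ 2 :=
      Finset.sum_mul_sq_le_sq_mul_sq _ _ _
    have h9 : 0 ≤ ∑ i, (μ i * p i) ^ 2 := Finset.sum_nonneg fun i _ => sq_nonneg _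
    have h10 : β ^ 2 ≤ ∑ i, (μ i * p i) ^ 2 := by
      calc β ^ 2 ≤ (∑ i, p i * (μ i * p i)) ^ 2 := by gcongr; exact hβφ.trans h7
        _ ≤ _ := h8
        _ ≤ 1 * ∑ i, (μ i * p i) ^ 2 := by gcongr
        _ = _ := one_mul _
    calc c * β ^ 2 ≤ c * ∑ i, (μ i * p i) ^ 2 := by gcongr
      _ = ∑ i, c * (μ i * p i) ^ 2 := Finset.mul_sum _ _ _
      _ ≤ ∑ i, a i * φ₁ i ^ 2 := by
        refine Finset.sum_le_sum fun i _ => ?_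
        rw [hφ i, hμ]
        dsimp only
        split_ifs with h
        · calc c * (-κ * lam i * p i) ^ 2 ≤ a i * (-κ * lam i * p i) ^ 2 := by
                gcongr; exact hac i h
            _ = _ := by ring
        · simpa using mul_nonneg (ha i) (sq_nonneg _)
  have h5 : ∑ i, a i * (φ₂ i + C * φ₁ i ^ 2) = ∑ i, a i * φ₂ i + C * ∑ i, a i * φ₁ i ^ 2 := by
    rw [Finset.mul_sum, ← Finset.sum_add_distrib]
    exact Finset.sum_congr rfl fun i _ => by ring
  rw [h5] at h3
  have := mul_le_mul_of_nonneg_left h4 hC.le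
  linarith

end pointwise

/-! ### The linearized operator -/

section linearization

open Matrix

variable {ι : Type*} [Fintype ι]

theorem hasDerivAt_matrix_mul {M N : ℝ → Matrix ι ι ℝ} {M' N' : Matrix ι ι ℝ} {x : ℝ}
    (hM : ∀ i j, HasDerivAt (fun s => M s i j) (M' i j) x)
    (hN : ∀ i j, HasDerivAt (fun s => N s i j) (N' i j) x) (i j : ι) :
    HasDerivAt (fun s => (M s * N s) i j) ((M' * N x + M x * N') i j) x := by
  simp only [mul_apply, Matrix.add_apply, ← Finset.sum_add_distrib]
  exact HasDerivAt.fun_sum fun l _ => (hM i l).mul (hN l j)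

variable [DecidableEq ι]

theorem graphCometric_mulVec_self (p : ι → ℝ) :
    graphCometric p *ᵥ p = (1 + p ⬝ᵥ p)⁻¹ • p := by
  have hne := (one_add_dotProduct_self_pos p).ne'
  rw [graphCometric, Matrix.sub_mulVec, one_mulVec, Matrix.smul_mulVec, vecMulVec_mulVec,
    op_smul_eq_smul, smul_smul]
  ext i
  simp only [Pi.sub_apply, Pi.smul_apply, smul_eq_mul]
  field_simp
  ring

/-- In a principal frame, the components of `H p` are proportional to those of `p`. -/
theorem frame_mulVec_hessian {p : ι → ℝ} {H R : Matrix ι ι ℝ} {lam : ι → ℝ}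
    (hR : Rᵀ * graphMetric p * R = 1) (hlam : Rᵀ * H * R = diagonal lam) (i : ι) :
    (Rᵀ *ᵥ (H *ᵥ p)) i = (1 + p ⬝ᵥ p) * (lam i * (Rᵀ *ᵥ p) i) := by
  have hne := (one_add_dotProduct_self_pos p).ne'
  have h2 : Rᵀ *ᵥ (H *ᵥ (graphCometric p *ᵥ p)) = diagonal lam *ᵥ (Rᵀ *ᵥ p) := by
    rw [← frame_mul_transpose hR, ← hlam]
    simp only [mulVec_mulVec, mul_assoc]
  have h3 := congrFun h2 i
  rw [graphCometric_mulVec_self, mulVec_smul, mulVec_smul, Pi.smul_apply, smul_eq_mul,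
    Matrix.mulVec_diagonal] at h3
  rw [← h3]
  field_simp

/-- The derivative of `Q(g⁻¹ H)` along a curve of gradients and Hessians, in a principal frame. The
gradient moves in the direction `H p`. -/
theorem hasDerivAt_quotient_cometric_mul {P : ℝ → ι → ℝ} {H : ℝ → Matrix ι ι ℝ}
    {p q : ι → ℝ} {H₀ H' R : Matrix ι ι ℝ} {lam : ι → ℝ} {k : ℕ}
    (hP : ∀ i, HasDerivAt (fun s => P s i) (q i) 0) (hP0 : P 0 = p)
    (hH : ∀ i j, HasDerivAt (fun s => H s i j) (H' i j) 0) (hH0 : H 0 = H₀) (hq : q = H₀ *ᵥ p)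
    (hR : Rᵀ * graphMetric p * R = 1) (hlam : Rᵀ * H₀ * R = diagonal lam)
    (hk : k < Fintype.card ι) (h0 : esym lam Finset.univ k ≠ 0) :
    HasDerivAt (fun s => matrixEsymm (k + 1) (graphCometric (P s) * H s)
        / matrixEsymm k (graphCometric (P s) * H s))
      (∑ i, quotDeriv lam k i *
        ((Rᵀ * H' * R) i i - 2 / (1 + p ⬝ᵥ p) * ((Rᵀ *ᵥ q) i) ^ 2)) 0 := by
  subst hP0 hH0
  set p := P 0
  have hRR := frame_mul_transpose hR
  -- differentiability of the inverse metric
  have hGd : ∀ i j, DifferentiableAt ℝ (fun s => graphCometric (P s) i j) 0 := by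
    intro i j
    simp only [graphCometric, Matrix.sub_apply, Matrix.smul_apply, vecMulVec_apply, smul_eq_mul,
      dotProduct]
    have h1 : ∀ i, DifferentiableAt ℝ (fun s => P s i) 0 := fun i => (hP i).differentiableAt
    have h2 : DifferentiableAt ℝ (fun s => 1 + ∑ i, P s i * P s i) 0 :=
      (DifferentiableAt.fun_sum fun i _ => (h1 i).mul (h1 i)).const_add _
    exact (((h2.inv (one_add_dotProduct_self_pos (P 0)).ne').mul
      ((h1 i).mul (h1 j)))).const_sub _
  set G' : Matrix ι ι ℝ := of fun i j => deriv (fun s => graphCometric (P s) i j) 0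
  have hG : ∀ i j, HasDerivAt (fun s => graphCometric (P s) i j) (G' i j) 0 := fun i j =>
    (hGd i j).hasDerivAt
  set g' : Matrix ι ι ℝ := vecMulVec q p + vecMulVec p q with hg'
  have hg : ∀ i j, HasDerivAt (fun s => graphMetric (P s) i j) (g' i j) 0 := by
    intro i j
    simp only [graphMetric, hg', Matrix.add_apply, vecMulVec_apply]
    exact ((hP i).mul (hP j)).const_add _
  -- Differentiating g g⁻¹ = 1 gives all that is needed about `G'`, which is never computed.
  have hgG : graphMetric p * G' = -(g' * graphCometric p) := by
    rw [eq_neg_iff_add_eq_zero, add_comm]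
    ext i j
    have h1 := hasDerivAt_matrix_mul hg hG i j
    simp only [graphMetric_mul_graphCometric] at h1
    exact h1.unique (hasDerivAt_const _ _)
  have hB := hasDerivAt_matrix_mul hG hH
  have hc : ∀ (M : Matrix ι ι ℝ) (i j), HasDerivAt (fun _ : ℝ => M i j) ((0 : Matrix ι ι ℝ) i j) 0 :=
    fun M i j => hasDerivAt_const _ _
  -- Conjugation by the constant matrix `R`, with inverse Rᵀ g at s = 0, leaves the symmetric
  -- functions unchanged and makes the curve diagonal at s = 0.
  have hN := hasDerivAt_matrix_mul
    (hasDerivAt_matrix_mul (hc (Rᵀ * graphMetric p)) hB) (hc R)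
  simp only [Matrix.zero_mul, zero_add, Matrix.mul_zero, add_zero] at hN
  have hN0 : Rᵀ * graphMetric p * (graphCometric p * H 0) * R = diagonal lam := by
    rw [coframe_mul_cometric, hlam]
  have hmain := hasDerivAt_matrixEsymm_div_of_diagonal hN hN0 hk h0
  simp only [matrixEsymm_conj _ (frame_mul_coframe hR)] at hmain
  refine hmain.congr_deriv (Finset.sum_congr rfl fun i _ => ?_)
  rw [mul_comm]
  congr 1
  have hGHR : graphCometric p * H 0 * R = R * diagonal lam := by
    rw [← hRR, ← hlam]; simp only [mul_assoc]
  have hRq : ∀ i, (Rᵀ *ᵥ q) i = (1 + p ⬝ᵥ p) * (lam i * (Rᵀ *ᵥ p) i) := fun i => by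
    rw [hq, frame_mulVec_hessian hR hlam]
  have e : Rᵀ * graphMetric p * (G' * H 0 + graphCometric p * H') * R
      = Rᵀ * H' * R - Rᵀ * g' * R * diagonal lam := by
    rw [mul_add, add_mul, coframe_mul_cometric, add_comm, sub_eq_add_neg]
    congr 1
    calc Rᵀ * graphMetric p * (G' * H 0) * R = Rᵀ * (graphMetric p * G') * H 0 * R := by
          simp only [mul_assoc]
      _ = -(Rᵀ * g' * (graphCometric p * H 0 * R)) := by
          rw [hgG]; simp only [mul_assoc, Matrix.mul_neg, Matrix.neg_mul]
      _ = _ := by rw [hGHR]; simp only [mul_assoc]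
  rw [e, Matrix.sub_apply, mul_diagonal]
  congr 1
  have e2 : (Rᵀ * g' * R) i i = 2 * (Rᵀ *ᵥ q) i * (Rᵀ *ᵥ p) i := by
    rw [hg', mul_add, add_mul, mul_vecMulVec, mul_vecMulVec, vecMulVec_mul, vecMulVec_mul,
      Matrix.add_apply, vecMulVec_apply, vecMulVec_apply, ← mulVec_transpose, ← mulVec_transpose]
    ring
  rw [e2, hRq i]
  have hne := (one_add_dotProduct_self_pos p).ne'
  field_simp

end linearization

/-! ### Derivatives along lines -/

section lines

open Filter Topology

variable {E F : Type*} [NormedAddCommGroup E] [NormedSpace ℝ E] [NormedAddCommGroup F]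
  [NormedSpace ℝ F]

theorem hasDerivAt_line (x a : E) (s : ℝ) : HasDerivAt (fun s : ℝ => x + s • a) a s := by
  simpa using ((hasDerivAt_id s).smul_const a).const_add x

theorem DifferentiableAt.hasDerivAt_comp_line {f : E → F} {x a : E} {s : ℝ}
    (hf : DifferentiableAt ℝ f (x + s • a)) :
    HasDerivAt (fun s : ℝ => f (x + s • a)) (fderiv ℝ f (x + s • a) a) s :=
  HasFDerivAt.comp_hasDerivAt s hf.hasFDerivAt (hasDerivAt_line x a s)

variable {f : E → ℝ} {x : E}

theorem ContDiffAt.hasDerivAt_line (hf : ContDiffAt ℝ 3 f x) {y a : E} {s : ℝ}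
    (hx : y + s • a = x) : HasDerivAt (fun s : ℝ => f (y + s • a)) (fderiv ℝ f x a) s := by
  subst hx
  exact (hf.differentiableAt (by norm_num)).hasDerivAt_comp_line

theorem ContDiffAt.contDiffAt_fderiv_two (hf : ContDiffAt ℝ 3 f x) :
    ContDiffAt ℝ 2 (fderiv ℝ f) x := hf.fderiv_right (by norm_num)

theorem ContDiffAt.contDiffAt_fderiv_fderiv_one (hf : ContDiffAt ℝ 3 f x) :
    ContDiffAt ℝ 1 (fderiv ℝ (fderiv ℝ f)) x :=
  hf.contDiffAt_fderiv_two.fderiv_right (by norm_num)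

theorem ContDiffAt.hasDerivAt_fderiv_line (hf : ContDiffAt ℝ 3 f x) {y a : E} {s : ℝ}
    (hx : y + s • a = x) (b : E) :
    HasDerivAt (fun s : ℝ => fderiv ℝ f (y + s • a) b) (fderiv ℝ (fderiv ℝ f) x a b) s := by
  subst hx
  have h := (hf.contDiffAt_fderiv_two.differentiableAt (by norm_num)).hasDerivAt_comp_line
  simpa using h.clm_apply (hasDerivAt_const s b)

theorem ContDiffAt.hasDerivAt_fderiv_fderiv_line (hf : ContDiffAt ℝ 3 f x) {y a : E} {s : ℝ}
    (hx : y + s • a = x) (b c : E) :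
    HasDerivAt (fun s : ℝ => fderiv ℝ (fderiv ℝ f) (y + s • a) b c)
      (fderiv ℝ (fderiv ℝ (fderiv ℝ f)) x a b c) s := by
  subst hx
  have h := (hf.contDiffAt_fderiv_fderiv_one.differentiableAt (by norm_num)).hasDerivAt_comp_line
  simpa using (h.clm_apply (hasDerivAt_const s b)).clm_apply (hasDerivAt_const s c)

theorem ContDiffAt.fderiv_fderiv_comm (hf : ContDiffAt ℝ 3 f x) (a b : E) :
    fderiv ℝ (fderiv ℝ f) x a b = fderiv ℝ (fderiv ℝ f) x b a :=
  hf.isSymmSndFDerivAt (by simp; norm_num) a b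

/-- The Hessian is symmetric at all points near x; differentiate that symmetry along `a`. -/
theorem ContDiffAt.fderiv_fderiv_fderiv_swap_right (hf : ContDiffAt ℝ 3 f x) (a b c : E) :
    fderiv ℝ (fderiv ℝ (fderiv ℝ f)) x a b c = fderiv ℝ (fderiv ℝ (fderiv ℝ f)) x a c b := by
  have hx : x + (0 : ℝ) • a = x := by simp
  have h1 := hf.hasDerivAt_fderiv_fderiv_line hx b c
  have h2 := hf.hasDerivAt_fderiv_fderiv_line hx c b
  refine h1.unique (h2.congr_of_eventuallyEq ?_)
  have hev : ∀ᶠ y in 𝓝 x, ContDiffAt ℝ 3 f y := hf.eventually (by simp)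
  have ht : Tendsto (fun s : ℝ => x + s • a) (𝓝 0) (𝓝 x) := by
    have := (_root_.hasDerivAt_line x a 0).continuousAt.tendsto
    rwa [hx] at this
  filter_upwards [ht.eventually hev] with s hs
  exact hs.fderiv_fderiv_comm b c

theorem ContDiffAt.fderiv_fderiv_fderiv_swap_left (hf : ContDiffAt ℝ 3 f x) (a b c : E) :
    fderiv ℝ (fderiv ℝ (fderiv ℝ f)) x a b c = fderiv ℝ (fderiv ℝ (fderiv ℝ f)) x b a c := by
  have h := hf.contDiffAt_fderiv_two.isSymmSndFDerivAt (by simp) a b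
  rw [h]

theorem iteratedFDeriv_three_apply (f : E → F) (x : E) (m : Fin 3 → E) :
    iteratedFDeriv ℝ 3 f x m = fderiv ℝ (fderiv ℝ (fderiv ℝ f)) x (m 0) (m 1) (m 2) := by
  rw [iteratedFDeriv_succ_apply_right, iteratedFDeriv_two_apply]
  rfl

end lines

/-! ### Gradient and Hessian in coordinates and in a frame -/

section coordinates

open Matrix

variable {n : ℕ}

theorem EuclideanSpace.sum_single_smul (v : EuclideanSpace ℝ (Fin n)) :
    v = ∑ i, v i • EuclideanSpace.single i (1 : ℝ) := by
  ext j
  simp [Pi.single_apply]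

theorem clm_apply_eq_sum (L : EuclideanSpace ℝ (Fin n) →L[ℝ] ℝ) (v : EuclideanSpace ℝ (Fin n)) :
    L v = ∑ i, v i * L (EuclideanSpace.single i 1) := by
  conv_lhs => rw [EuclideanSpace.sum_single_smul v]
  simp

theorem clm_apply_apply_eq_sum
    (L : EuclideanSpace ℝ (Fin n) →L[ℝ] EuclideanSpace ℝ (Fin n) →L[ℝ] ℝ)
    (v w : EuclideanSpace ℝ (Fin n)) :
    L v w = ∑ i, ∑ j, v i * L (EuclideanSpace.single i 1) (EuclideanSpace.single j 1) * w j := by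
  conv_lhs => rw [EuclideanSpace.sum_single_smul v]
  simp only [map_sum, map_smul, _root_.sum_apply, _root_.smul_apply,
    smul_eq_mul]
  refine Finset.sum_congr rfl fun i _ => ?_
  rw [clm_apply_eq_sum _ w, Finset.mul_sum]
  exact Finset.sum_congr rfl fun j _ => by ring

variable {f : EuclideanSpace ℝ (Fin n) → ℝ} {x : EuclideanSpace ℝ (Fin n)}

theorem fderiv_eq_inner_gradient (v : EuclideanSpace ℝ (Fin n)) :
    fderiv ℝ f x v = inner ℝ (gradient f x) v := by
  rw [gradient, InnerProductSpace.toDual_symm_apply]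

theorem gradient_apply (i : Fin n) :
    (gradient f x) i = fderiv ℝ f x (EuclideanSpace.single i 1) := by
  rw [fderiv_eq_inner_gradient, EuclideanSpace.inner_single_right]
  simp

theorem gradient_dotProduct_self :
    (gradient f x).ofLp ⬝ᵥ (gradient f x).ofLp = ‖gradient f x‖ ^ 2 := by
  rw [EuclideanSpace.real_norm_sq_eq]
  simp [dotProduct, sq]

theorem hessianMatrix_apply (i j : Fin n) : hessianMatrix f x i j
    = fderiv ℝ (fderiv ℝ f) x (EuclideanSpace.single i 1) (EuclideanSpace.single j 1) := by
  rw [hessianMatrix, of_apply, iteratedFDeriv_two_apply]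
  rfl

theorem hessianMatrix_isHermitian (hf : ContDiffAt ℝ 3 f x) : (hessianMatrix f x).IsHermitian := by
  ext i j
  rw [conjTranspose_apply, star_trivial, hessianMatrix_apply, hessianMatrix_apply,
    hf.fderiv_fderiv_comm]

/-- The vector whose coordinates form the `i`-th column of `R`. -/
def frameVector (R : Matrix (Fin n) (Fin n) ℝ) (i : Fin n) : EuclideanSpace ℝ (Fin n) :=
  WithLp.toLp 2 fun j => R j i

theorem clm_frameVector (L : EuclideanSpace ℝ (Fin n) →L[ℝ] ℝ) (R : Matrix (Fin n) (Fin n) ℝ)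
    (i : Fin n) :
    L (frameVector R i) = (Rᵀ *ᵥ fun j => L (EuclideanSpace.single j 1)) i := by
  rw [clm_apply_eq_sum]
  rfl

theorem clm_frameVector_frameVector
    (L : EuclideanSpace ℝ (Fin n) →L[ℝ] EuclideanSpace ℝ (Fin n) →L[ℝ] ℝ)
    (R : Matrix (Fin n) (Fin n) ℝ) (i : Fin n) :
    L (frameVector R i) (frameVector R i) = (Rᵀ * of (fun j l =>
      L (EuclideanSpace.single j 1) (EuclideanSpace.single l 1)) * R) i i := by
  rw [clm_apply_apply_eq_sum, Finset.sum_comm]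
  simp only [mul_apply, Finset.sum_mul, transpose_apply, of_apply]
  rfl

theorem hessianMatrix_mulVec_gradient (hf : ContDiffAt ℝ 3 f x) :
    hessianMatrix f x *ᵥ (gradient f x).ofLp
      = fun i => fderiv ℝ (fderiv ℝ f) x (gradient f x) (EuclideanSpace.single i 1) := by
  ext i
  rw [hf.fderiv_fderiv_comm, clm_apply_eq_sum]
  simp only [mulVec, dotProduct, hessianMatrix_apply]
  exact Finset.sum_congr rfl fun j _ => mul_comm _ _

end coordinates

/-! ### The flow equation and its derivative in space -/

section flow

open Matrix Filter Topology

variable {n k : ℕ} {r T : ℝ} {u : EuclideanSpace ℝ (Fin n) → ℝ → ℝ}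

theorem IsGraphicalFlow.contDiffAt (hu : IsGraphicalFlow k r T u)
    {x : EuclideanSpace ℝ (Fin n)} (hx : x ∈ Metric.ball 0 r) {t : ℝ} (ht : t ∈ Ioc 0 T) :
    ContDiffAt ℝ 3 (fun y => u y t) x :=
  (hu.contDiffOn t ht).contDiffAt (Metric.isOpen_ball.mem_nhds hx)

theorem IsGraphicalFlow.continuousOn_self (hu : IsGraphicalFlow k r T u) :
    ContinuousOn (fun z : EuclideanSpace ℝ (Fin n) × ℝ => u z.1 z.2) (flowCylinder n r T) := by
  have h := (hu.continuousOn 0 (by norm_num)).eval_const ![]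
  simpa using h

theorem IsGraphicalFlow.continuousOn_fderiv (hu : IsGraphicalFlow k r T u)
    (a : EuclideanSpace ℝ (Fin n)) :
    ContinuousOn (fun z : EuclideanSpace ℝ (Fin n) × ℝ => fderiv ℝ (fun y => u y z.2) z.1 a)
      (flowCylinder n r T) := by
  have h := (hu.continuousOn 1 (by norm_num)).eval_const ![a]
  simpa using h

theorem IsGraphicalFlow.continuousOn_fderiv_fderiv (hu : IsGraphicalFlow k r T u)
    (a b : EuclideanSpace ℝ (Fin n)) :
    ContinuousOn (fun z : EuclideanSpace ℝ (Fin n) × ℝ =>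
      fderiv ℝ (fderiv ℝ (fun y => u y z.2)) z.1 a b) (flowCylinder n r T) := by
  have h := (hu.continuousOn 2 (by norm_num)).eval_const ![a, b]
  simpa [iteratedFDeriv_two_apply] using h

theorem IsGraphicalFlow.continuousOn_fderiv_fderiv_fderiv (hu : IsGraphicalFlow k r T u)
    (a b c : EuclideanSpace ℝ (Fin n)) :
    ContinuousOn (fun z : EuclideanSpace ℝ (Fin n) × ℝ =>
      fderiv ℝ (fderiv ℝ (fderiv ℝ (fun y => u y z.2))) z.1 a b c) (flowCylinder n r T) := by
  have h := (hu.continuousOn 3 (by norm_num)).eval_const ![a, b, c]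
  simpa [iteratedFDeriv_three_apply] using h

/-- The right-hand side of the flow as a function of the gradient and the Hessian. -/
noncomputable def flowSpeed (k : ℕ) (J : (Fin n → ℝ) × (Fin n → Fin n → ℝ)) : ℝ :=
  matrixEsymm (k + 1) (graphCometric J.1 * of J.2) / matrixEsymm k (graphCometric J.1 * of J.2)

theorem contDiffAt_flowSpeed {J : (Fin n → ℝ) × (Fin n → Fin n → ℝ)}
    (hJ : matrixEsymm k (graphCometric J.1 * of J.2) ≠ 0) {m : WithTop ℕ∞} :
    ContDiffAt ℝ m (flowSpeed k) J := by
  have h1 : ContDiff ℝ m fun J : (Fin n → ℝ) × (Fin n → Fin n → ℝ) =>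
      (fun i j => (graphCometric J.1 * of J.2) i j : Fin n → Fin n → ℝ) := by
    refine contDiff_pi.2 fun i => contDiff_pi.2 fun j => ?_
    simp only [mul_apply, graphCometric, Matrix.sub_apply, Matrix.smul_apply, vecMulVec_apply,
      smul_eq_mul, dotProduct, of_apply]
    have h2 : ContDiff ℝ m fun J : (Fin n → ℝ) × (Fin n → Fin n → ℝ) =>
        (1 + ∑ i, J.1 i * J.1 i)⁻¹ :=
      ContDiff.inv (by fun_prop) fun J => (one_add_dotProduct_self_pos J.1).ne'
    fun_prop
  have h2 : ∀ l, ContDiff ℝ m fun J : (Fin n → ℝ) × (Fin n → Fin n → ℝ) =>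
      matrixEsymm l (graphCometric J.1 * of J.2) := fun l => (contDiff_matrixEsymm l).comp h1
  exact (h2 (k + 1)).contDiffAt.div (h2 k).contDiffAt hJ

/-- The gradient and the Hessian, in coordinates. -/
noncomputable def coordJet (f : EuclideanSpace ℝ (Fin n) → ℝ) (x : EuclideanSpace ℝ (Fin n)) :
    (Fin n → ℝ) × (Fin n → Fin n → ℝ) :=
  (fun i => fderiv ℝ f x (EuclideanSpace.single i 1), fun i j =>
    fderiv ℝ (fderiv ℝ f) x (EuclideanSpace.single i 1) (EuclideanSpace.single j 1))

/-- The directional derivative of `coordJet`. -/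
noncomputable def coordJetDeriv (f : EuclideanSpace ℝ (Fin n) → ℝ)
    (x a : EuclideanSpace ℝ (Fin n)) : (Fin n → ℝ) × (Fin n → Fin n → ℝ) :=
  (fun i => fderiv ℝ (fderiv ℝ f) x a (EuclideanSpace.single i 1), fun i j =>
    fderiv ℝ (fderiv ℝ (fderiv ℝ f)) x a (EuclideanSpace.single i 1) (EuclideanSpace.single j 1))

theorem hasDerivAt_coordJet {f : EuclideanSpace ℝ (Fin n) → ℝ} {x y a : EuclideanSpace ℝ (Fin n)}
    {s : ℝ} (hf : ContDiffAt ℝ 3 f x) (hx : y + s • a = x) :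
    HasDerivAt (fun s : ℝ => coordJet f (y + s • a)) (coordJetDeriv f x a) s :=
  (hasDerivAt_pi.2 fun _ => hf.hasDerivAt_fderiv_line hx _).prodMk
    (hasDerivAt_pi.2 fun _ => hasDerivAt_pi.2 fun _ => hf.hasDerivAt_fderiv_fderiv_line hx _ _)

theorem cometricHessian_eq (f : EuclideanSpace ℝ (Fin n) → ℝ) (x : EuclideanSpace ℝ (Fin n)) :
    cometricHessian f x = graphCometric (coordJet f x).1 * of (coordJet f x).2 := by
  have h1 : (coordJet f x).1 = (gradient f x).ofLp := by
    ext i; exact (gradient_apply i).symm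
  have h2 : of (coordJet f x).2 = hessianMatrix f x := by
    ext i j; exact (hessianMatrix_apply i j).symm
  rw [h1, h2, cometricHessian]

theorem IsGraphicalFlow.hasDerivWithinAt_time (hk : k < n) (hu : IsGraphicalFlow k r T u)
    {x : EuclideanSpace ℝ (Fin n)} (hx : x ∈ Metric.ball 0 r) {t : ℝ} (ht : t ∈ Ioc 0 T) :
    HasDerivWithinAt (fun s => u x s) (flowSpeed k (coordJet (fun y => u y t) x)) (Ioc 0 T) t := by
  have h := hu.equation x hx t ht
  rwa [curvatureQuotient_mul_slopeFactor (hessianMatrix_isHermitian (hu.contDiffAt hx ht)) hk,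
    cometricHessian_eq] at h

/-- The evolution of a component of the gradient, in a principal frame. -/
theorem IsGraphicalFlow.hasDerivWithinAt_fderiv (hk : k < n) (hu : IsGraphicalFlow k r T u)
    (hadm : ∀ x ∈ Metric.ball (0 : EuclideanSpace ℝ (Fin n)) r, ∀ t ∈ Ioc 0 T,
      principalCurvatures (fun y => u y t) x ∈ gammaCone (k + 1))
    {x : EuclideanSpace ℝ (Fin n)} (hx : x ∈ Metric.ball 0 r) {t : ℝ} (ht : t ∈ Ioc 0 T)
    {f : EuclideanSpace ℝ (Fin n) → ℝ} (hf : f = fun y => u y t)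
    {p : EuclideanSpace ℝ (Fin n)} (hp : p = gradient f x)
    {R : Matrix (Fin n) (Fin n) ℝ} {lam : Fin n → ℝ}
    (hR : Rᵀ * graphMetric p.ofLp * R = 1) (hlam : Rᵀ * hessianMatrix f x * R = diagonal lam) :
    HasDerivWithinAt (fun τ => fderiv ℝ (fun y => u y τ) x p)
      (∑ i, quotDeriv lam k i *
        (fderiv ℝ (fderiv ℝ (fderiv ℝ f)) x p (frameVector R i) (frameVector R i)
          - 2 / (1 + ‖p‖ ^ 2) * (fderiv ℝ (fderiv ℝ f) x p (frameVector R i)) ^ 2))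
      (Ioc 0 T) t := by
  have hfx : ContDiffAt ℝ 3 f x := hf ▸ hu.contDiffAt hx ht
  have hx0 : x + (0 : ℝ) • p = x := by simp
  have hpos : ∀ x ∈ Metric.ball (0 : EuclideanSpace ℝ (Fin n)) r, ∀ t ∈ Ioc 0 T,
      matrixEsymm k (graphCometric (coordJet (fun y => u y t) x).1
        * of (coordJet (fun y => u y t) x).2) ≠ 0 := by
    intro x hx t ht
    rw [← cometricHessian_eq]
    exact (matrixEsymm_cometricHessian_pos (hessianMatrix_isHermitian (hu.contDiffAt hx ht)) hk
      (hadm x hx t ht) (Nat.le_succ k)).ne'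
  -- the line through `x` in the direction `p` stays in the ball for a while
  have hline : ContinuousAt (fun s : ℝ => x + s • p) 0 := (hasDerivAt_line x p 0).continuousAt
  obtain ⟨ρ, hρ, hball⟩ : ∃ ρ > 0, ∀ s ∈ Metric.ball (0 : ℝ) ρ, x + s • p ∈ Metric.ball 0 r := by
    have := hline.preimage_mem_nhds (t := Metric.ball 0 r)
      (Metric.isOpen_ball.mem_nhds (by rwa [hx0]))
    exact Metric.mem_nhds_iff.1 this
  have hgs : ∀ s ∈ Metric.ball (0 : ℝ) ρ, ∀ τ ∈ Ioc 0 T,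
      HasDerivAt (fun s : ℝ => flowSpeed k (coordJet (fun y => u y τ) (x + s • p)))
        (fderiv ℝ (flowSpeed k) (coordJet (fun y => u y τ) (x + s • p))
          (coordJetDeriv (fun y => u y τ) (x + s • p) p)) s := by
    intro s hs τ hτ
    have h1 := ((contDiffAt_flowSpeed (hpos _ (hball s hs) τ hτ) (m := 1)).differentiableAt
      one_ne_zero).hasFDerivAt
    exact h1.comp_hasDerivAt s (hasDerivAt_coordJet (hu.contDiffAt (hball s hs) hτ) rfl)
  have hmaps : MapsTo (fun z : ℝ × ℝ => (x + z.1 • p, z.2)) (Metric.ball 0 ρ ×ˢ Ioc 0 T)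
      (flowCylinder n r T) := fun z hz => ⟨hball z.1 hz.1, hz.2⟩
  have hmcont : Continuous fun z : ℝ × ℝ => (x + z.1 • p, z.2) := by fun_prop
  have hmem : ((0 : ℝ), t) ∈ Metric.ball (0 : ℝ) ρ ×ˢ Ioc 0 T := ⟨Metric.mem_ball_self hρ, ht⟩
  have hJ : ContinuousWithinAt (fun z : ℝ × ℝ => coordJet (fun y => u y z.2) (x + z.1 • p))
      (Metric.ball 0 ρ ×ˢ Ioc 0 T) (0, t) :=
    (continuousWithinAt_pi.2 fun i => ((hu.continuousOn_fderiv _).comp hmcont.continuousOn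
      hmaps) _ hmem).prodMk (continuousWithinAt_pi.2 fun i => continuousWithinAt_pi.2 fun j =>
        ((hu.continuousOn_fderiv_fderiv _ _).comp hmcont.continuousOn hmaps) _ hmem)
  have hJ' : ContinuousWithinAt
      (fun z : ℝ × ℝ => coordJetDeriv (fun y => u y z.2) (x + z.1 • p) p)
      (Metric.ball 0 ρ ×ˢ Ioc 0 T) (0, t) :=
    (continuousWithinAt_pi.2 fun i => ((hu.continuousOn_fderiv_fderiv _ _).comp
      hmcont.continuousOn hmaps) _ hmem).prodMk
      (continuousWithinAt_pi.2 fun i => continuousWithinAt_pi.2 fun j =>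
        ((hu.continuousOn_fderiv_fderiv_fderiv _ _ _).comp hmcont.continuousOn hmaps) _ hmem)
  have hfc : ContinuousAt (fderiv ℝ (flowSpeed (n := n) k))
      (coordJet (fun y => u y t) (x + (0 : ℝ) • p)) :=
    ((contDiffAt_flowSpeed (hpos _ (hball 0 hmem.1) t ht) (m := 2)).fderiv_right
      (m := 1) (by norm_num)).continuousAt
  have hmixed := hasDerivWithinAt_of_mixed (convex_Ioc 0 T) hρ ht
    (h := fun s τ => u (x + s • p) τ)
    (g := fun s τ => flowSpeed k (coordJet (fun y => u y τ) (x + s • p)))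
    (gs := fun s τ => fderiv ℝ (flowSpeed k) (coordJet (fun y => u y τ) (x + s • p))
          (coordJetDeriv (fun y => u y τ) (x + s • p) p))
    (v := fun τ => fderiv ℝ (fun y => u y τ) x p)
    (fun s hs τ hτ => hu.hasDerivWithinAt_time hk (hball s hs) hτ) hgs
    ((hfc.comp_continuousWithinAt (f := fun z : ℝ × ℝ =>
      coordJet (fun y => u y z.2) (x + z.1 • p)) hJ).clm_apply hJ')
    (fun τ hτ => (hu.contDiffAt hx hτ).hasDerivAt_line hx0)
  -- The chain rule form of the derivative is the one whose joint continuity is clear; uniqueness of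
  -- derivatives identifies its value with the formula in the principal frame.
  refine hmixed.congr_deriv ((hgs 0 hmem.1 t ht).unique ?_)
  have hlam0 : esym lam Finset.univ k ≠ 0 := by
    rw [← matrixEsymm_diagonal (by simpa using hk.le) lam, ← hlam, ← coframe_mul_cometric,
      matrixEsymm_conj _ (frame_mul_coframe hR), hp, hf]
    have := hpos x hx t ht
    rwa [← cometricHessian_eq] at this
  rw [← hf]
  have hfin := hasDerivAt_quotient_cometric_mul
    (P := fun s => (gradient f (x + s • p)).ofLp)
    (H := fun s => hessianMatrix f (x + s • p)) (p := p.ofLp)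
    (q := fun i => fderiv ℝ (fderiv ℝ f) x p (EuclideanSpace.single i 1))
    (H₀ := hessianMatrix f x)
    (H' := of fun i j => fderiv ℝ (fderiv ℝ (fderiv ℝ f)) x p (EuclideanSpace.single i 1)
      (EuclideanSpace.single j 1)) (k := k)
    (fun i => by simp only [gradient_apply]; exact hfx.hasDerivAt_fderiv_line hx0 _)
    (by simp only [hx0]; rw [hp])
    (fun i j => by simp only [hessianMatrix_apply]; exact hfx.hasDerivAt_fderiv_fderiv_line hx0 _ _)
    (by simp only [hx0]) (by rw [hp, hessianMatrix_mulVec_gradient hfx])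
    hR hlam (by simpa using hk) hlam0
  have e : ∀ s : ℝ, flowSpeed k (coordJet f (x + s • p))
      = matrixEsymm (k + 1) (graphCometric (gradient f (x + s • p)).ofLp
          * hessianMatrix f (x + s • p))
        / matrixEsymm k (graphCometric (gradient f (x + s • p)).ofLp
          * hessianMatrix f (x + s • p)) := by
    intro s
    rw [flowSpeed, ← cometricHessian_eq, cometricHessian]
  simp only [e]
  refine hfin.congr_deriv (Finset.sum_congr rfl fun i _ => ?_)
  rw [clm_frameVector_frameVector, clm_frameVector]
  congr 3
  rw [hp, gradient_dotProduct_self]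

end flow

/-! ### The gradient at a maximum point of the test function -/

section oneDim

open Filter Topology

/-- First and second order conditions at a local maximum of `(exp (C φ) - 1) V`. -/
theorem isLocalMax_exp_mul_conditions {φ φ' V V' : ℝ → ℝ} {φ'' V'' C x : ℝ}
    (h : IsLocalMax (fun s => (Real.exp (C * φ s) - 1) * V s) x)
    (hφ : ∀ᶠ s in 𝓝 x, HasDerivAt φ (φ' s) s) (hφ' : HasDerivAt φ' φ'' x)
    (hV : ∀ᶠ s in 𝓝 x, HasDerivAt V (V' s) s) (hV' : HasDerivAt V' V'' x) :
    C * φ' x * Real.exp (C * φ x) * V x + (Real.exp (C * φ x) - 1) * V' x = 0 ∧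
    (C * φ'' + (C * φ' x) ^ 2) * Real.exp (C * φ x) * V x
      + 2 * (C * φ' x * Real.exp (C * φ x) * V' x) + (Real.exp (C * φ x) - 1) * V'' ≤ 0 := by
  have hE : ∀ᶠ s in 𝓝 x, HasDerivAt (fun s => Real.exp (C * φ s))
      (Real.exp (C * φ s) * (C * φ' s)) s := by
    filter_upwards [hφ] with s hs using (hs.const_mul C).exp
  have h1 : ∀ᶠ s in 𝓝 x, HasDerivAt (fun s => (Real.exp (C * φ s) - 1) * V s)
      (Real.exp (C * φ s) * (C * φ' s) * V s + (Real.exp (C * φ s) - 1) * V' s) s := by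
    filter_upwards [hE, hV] with s hs hs' using (hs.sub_const 1).mul hs'
  have hE0 := hE.self_of_nhds
  have h2 := ((hE0.mul (hφ'.const_mul C)).mul hV.self_of_nhds).add ((hE0.sub_const 1).mul hV')
  constructor
  · have := h.hasDerivAt_eq_zero h1.self_of_nhds
    linarith
  · have := h.hasDerivAt_hasDerivAt_nonpos h1 h2
    simp only [Pi.mul_apply] at this
    linarith

/-- Only earlier times are compared, so that the maximum may occur at the final time. -/
theorem HasDerivWithinAt.nonneg_of_le_left {g : ℝ → ℝ} {g' T t : ℝ} (ht : t ∈ Ioc 0 T)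
    (hg : HasDerivWithinAt g g' (Ioc 0 T) t) (h : ∀ᶠ τ in 𝓝[Iio t] t, g τ ≤ g t) : 0 ≤ g' := by
  have hmono : HasDerivWithinAt g g' (Ioo 0 t) t :=
    hg.mono fun τ hτ => ⟨hτ.1, hτ.2.le.trans ht.2⟩
  rw [hasDerivWithinAt_iff_tendsto_slope' (fun h => lt_irrefl _ h.2)] at hmono
  have : (𝓝[Ioo 0 t] t).NeBot := right_nhdsWithin_Ioo_neBot ht.1
  refine ge_of_tendsto hmono ?_
  have h2 : 𝓝[Ioo 0 t] t ≤ 𝓝[Iio t] t := nhdsWithin_mono _ fun τ hτ => hτ.2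
  filter_upwards [h2 h, self_mem_nhdsWithin] with τ h3 h4
  rw [slope_def_field]
  exact div_nonneg_of_nonpos (by simpa using h3) (by linarith [h4.2])

end oneDim

/-! ### Vectors of a frame orthonormal for the graph metric -/

section frameVectors

open Matrix

variable {n : ℕ} {p : EuclideanSpace ℝ (Fin n)} {R : Matrix (Fin n) (Fin n) ℝ}

theorem inner_frameVector (z : EuclideanSpace ℝ (Fin n)) (i : Fin n) :
    inner ℝ z (frameVector R i) = (Rᵀ *ᵥ z.ofLp) i := by
  simp [frameVector, PiLp.inner_apply, mulVec, dotProduct]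

theorem EuclideanSpace.ofLp_dotProduct_ofLp (x y : EuclideanSpace ℝ (Fin n)) :
    x.ofLp ⬝ᵥ y.ofLp = inner ℝ x y := by
  simp [PiLp.inner_apply, dotProduct, mul_comm]

/-- The sum is ⟨g⁻¹ p, z⟩, because R Rᵀ = g⁻¹, and g⁻¹ p = p/(1 + |p|²). -/
theorem sum_inner_frameVector_mul (hR : Rᵀ * graphMetric p.ofLp * R = 1)
    (z : EuclideanSpace ℝ (Fin n)) :
    ∑ i, inner ℝ p (frameVector R i) * inner ℝ z (frameVector R i)
      = inner ℝ p z / (1 + ‖p‖ ^ 2) := by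
  simp only [inner_frameVector]
  change (Rᵀ *ᵥ p.ofLp) ⬝ᵥ (Rᵀ *ᵥ z.ofLp) = _
  rw [dotProduct_comm, mulVec_transpose R z.ofLp, ← dotProduct_mulVec, mulVec_mulVec,
    frame_mul_transpose hR, graphCometric_mulVec_self, dotProduct_smul,
    EuclideanSpace.ofLp_dotProduct_ofLp, EuclideanSpace.ofLp_dotProduct_ofLp,
    real_inner_self_eq_norm_sq, real_inner_comm, smul_eq_mul, div_eq_inv_mul]

/-- A frame vector e satisfies 1 = g(e, e) = |e|² + ⟨p, e⟩². -/
theorem norm_frameVector_sq_le (hR : Rᵀ * graphMetric p.ofLp * R = 1) (i : Fin n) :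
    ‖frameVector R i‖ ^ 2 ≤ 1 := by
  have h := congrFun (congrFun hR i) i
  rw [graphMetric, mul_add, mul_one, add_mul, Matrix.add_apply, mul_vecMulVec, vecMulVec_mul,
    vecMulVec_apply, ← mulVec_transpose, one_apply_eq] at h
  have h1 : (Rᵀ * R) i i = ‖frameVector R i‖ ^ 2 := by
    rw [EuclideanSpace.real_norm_sq_eq, mul_apply]
    simp [frameVector, sq]
  rw [← h1]
  nlinarith [mul_self_nonneg ((Rᵀ *ᵥ p.ofLp) i)]

end frameVectors

/-! ### The test function and the gradient bound at its maximum -/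

section testFunction

open Matrix Filter Topology

variable {n k : ℕ} {r T : ℝ} {u : EuclideanSpace ℝ (Fin n) → ℝ → ℝ}

/-- The cutoff function `(t/T) (1 - |x|²/r²) + (u - m)/(2N) - 1/4`. -/
noncomputable def flowCutoff (u : EuclideanSpace ℝ (Fin n) → ℝ → ℝ) (r T m N : ℝ)
    (x : EuclideanSpace ℝ (Fin n)) (t : ℝ) : ℝ :=
  t / T * (1 - ‖x‖ ^ 2 / r ^ 2) + (u x t - m) / (2 * N) - 1 / 4

theorem hasDerivAt_flowCutoff_line {m N t : ℝ} {x y a : EuclideanSpace ℝ (Fin n)} {s : ℝ}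
    (hf : ContDiffAt ℝ 3 (fun y => u y t) y) (hy : x + s • a = y) :
    HasDerivAt (fun s : ℝ => flowCutoff u r T m N (x + s • a) t)
      (t / T * (-(2 * inner ℝ (x + s • a) a / r ^ 2))
        + fderiv ℝ (fun y => u y t) (x + s • a) a / (2 * N)) s := by
  have h1 : HasDerivAt (fun s : ℝ => ‖x + s • a‖ ^ 2) (2 * inner ℝ (x + s • a) a) s :=
    (hasDerivAt_line x a s).norm_sq
  have h2 := hf.hasDerivAt_line hy
  rw [hy] at h1 ⊢
  exact ((((h1.div_const (r ^ 2)).const_sub 1).const_mul (t / T)).add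
    ((h2.sub_const m).div_const (2 * N))).sub_const (1 / 4)

theorem hasDerivAt_deriv_flowCutoff_line {N t : ℝ} {x a : EuclideanSpace ℝ (Fin n)}
    (hf : ContDiffAt ℝ 3 (fun y => u y t) x) :
    HasDerivAt (fun s : ℝ => t / T * (-(2 * inner ℝ (x + s • a) a / r ^ 2))
        + fderiv ℝ (fun y => u y t) (x + s • a) a / (2 * N))
      (t / T * (-(2 * ‖a‖ ^ 2 / r ^ 2))
        + fderiv ℝ (fderiv ℝ (fun y => u y t)) x a a / (2 * N)) 0 := by
  have hx : x + (0 : ℝ) • a = x := by simp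
  have h1 : HasDerivAt (fun s : ℝ => inner ℝ (x + s • a) a) (‖a‖ ^ 2) 0 := by
    have := (hasDerivAt_line x a 0).inner ℝ (hasDerivAt_const (0 : ℝ) a)
    simpa [real_inner_self_eq_norm_sq] using this
  exact ((((h1.const_mul 2).div_const (r ^ 2)).neg).const_mul (t / T)).add
    ((hf.hasDerivAt_fderiv_line hx a).div_const (2 * N))

/-- Cauchy-Schwarz for the vectors (1, Dg) and (1, Df). It allows w to be replaced at a maximum
point by a function affine in the gradient. -/
theorem one_add_fderiv_le_slopeFactor_mul {f g : EuclideanSpace ℝ (Fin n) → ℝ}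
    {x y : EuclideanSpace ℝ (Fin n)} :
    1 + fderiv ℝ g y (gradient f x) ≤ slopeFactor g y * slopeFactor f x := by
  rw [slopeFactor, slopeFactor, ← Real.sqrt_mul (by positivity)]
  refine Real.le_sqrt_of_sq_le ?_
  rw [fderiv_eq_inner_gradient]
  have h := abs_real_inner_le_norm (gradient g y) (gradient f x)
  have h1 := abs_le.1 h
  set a := ‖gradient g y‖
  set b := ‖gradient f x‖
  have ha : 0 ≤ a := norm_nonneg _
  have hb : 0 ≤ b := norm_nonneg _
  set c := inner ℝ (gradient g y) (gradient f x)
  have hc : c ^ 2 ≤ (a * b) ^ 2 := sq_le_sq' h1.1 h1.2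
  nlinarith [sq_nonneg (a - b), h1.2]

theorem slopeFactor_mul_self (f : EuclideanSpace ℝ (Fin n) → ℝ) (x : EuclideanSpace ℝ (Fin n)) :
    slopeFactor f x * slopeFactor f x = 1 + ‖gradient f x‖ ^ 2 :=
  Real.mul_self_sqrt (by positivity)

set_option maxHeartbeats 1600000 in
-- A larger gradient would make the cutoff increase along p at a definite rate. The first order
-- condition then forces directions of nonpositive curvature, where the operator is uniformly
-- elliptic, and the term with `C` breaks the maximum principle.
theorem IsGraphicalFlow.norm_gradient_le_of_isLocalMax (hk : k < n) (hr : 0 < r) (hT : 0 < T)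
    (hu : IsGraphicalFlow k r T u)
    (hadm : ∀ x ∈ Metric.ball (0 : EuclideanSpace ℝ (Fin n)) r, ∀ t ∈ Ioc 0 T,
      principalCurvatures (fun y => u y t) x ∈ gammaCone (k + 1))
    {x : EuclideanSpace ℝ (Fin n)} (hx : x ∈ Metric.ball 0 r) {t : ℝ} (ht : t ∈ Ioc 0 T)
    {m N C : ℝ} (hN : r ≤ N) (hC : C = 64 * N ^ 2 * n * (2 * n + 1) * (1 / T + 1 / r ^ 2))
    (hφ : 0 < flowCutoff u r T m N x t)
    (hspace : IsLocalMax (fun y => (Real.exp (C * flowCutoff u r T m N y t) - 1)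
      * slopeFactor (fun y => u y t) y) x)
    (htime : ∀ᶠ τ in 𝓝[Iio t] t, (Real.exp (C * flowCutoff u r T m N x τ) - 1)
        * slopeFactor (fun y => u y τ) x
      ≤ (Real.exp (C * flowCutoff u r T m N x t) - 1) * slopeFactor (fun y => u y t) x) :
    ‖gradient (fun y => u y t) x‖ ≤ 8 * N / r := by
  by_contra! hlarge
  have hNpos : 0 < N := hr.trans_le hN
  have hn : (1 : ℝ) ≤ n := by exact_mod_cast (by omega : 1 ≤ n)
  have hCpos : 0 < C := by rw [hC]; positivity
  set f : EuclideanSpace ℝ (Fin n) → ℝ := fun y => u y t with hf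
  have hfx : ContDiffAt ℝ 3 f x := hu.contDiffAt hx ht
  set p := gradient f x with hp
  set φ := flowCutoff u r T m N with hφdef
  obtain ⟨R, lam, hR, hlam⟩ := exists_principal_frame p.ofLp (hessianMatrix_isHermitian hfx)
  have hcardn : Fintype.card (Fin n) = n := Fintype.card_fin n
  have hkc : k < Fintype.card (Fin n) := by rwa [hcardn]
  -- the eigenvalues lie in the cone
  have hconj : ∀ l ≤ n, matrixEsymm l (cometricHessian f x) = esym lam Finset.univ l := by
    intro l hl
    rw [← matrixEsymm_diagonal (by rwa [hcardn]) lam, ← hlam, ← coframe_mul_cometric,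
      matrixEsymm_conj _ (frame_mul_coframe hR), cometricHessian]
  have hS : ∀ l ≤ k + 1, 0 < esym lam Finset.univ l := by
    intro l hl
    rw [← hconj l (by omega)]
    exact matrixEsymm_cometricHessian_pos (hessianMatrix_isHermitian hfx) hk (hadm x hx t ht) hl
  have hspeed : flowSpeed k (coordJet f x) = ∑ i, quotDeriv lam k i * lam i := by
    rw [sum_quotDeriv_mul lam hkc (hS k (by omega)), flowSpeed, ← cometricHessian_eq,
      hconj _ hk, hconj _ hk.le]
  -- the linear comparison function
  set V : EuclideanSpace ℝ (Fin n) → ℝ → ℝ := fun y τ => 1 + fderiv ℝ (fun y => u y τ) y p with hV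
  have hVx : V x t = 1 + ‖p‖ ^ 2 := by
    rw [hV]
    change 1 + fderiv ℝ f x p = _
    rw [fderiv_eq_inner_gradient, ← hp, real_inner_self_eq_norm_sq]
  have hcomp : ∀ y τ, 0 ≤ Real.exp (C * φ y τ) - 1 →
      (Real.exp (C * φ y τ) - 1) * slopeFactor (fun y => u y τ) y
        ≤ (Real.exp (C * φ x t) - 1) * slopeFactor f x →
      (Real.exp (C * φ y τ) - 1) * V y τ ≤ (Real.exp (C * φ x t) - 1) * V x t := by
    intro y τ h0 h1
    calc (Real.exp (C * φ y τ) - 1) * V y τ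
        ≤ (Real.exp (C * φ y τ) - 1) * (slopeFactor (fun y => u y τ) y * slopeFactor f x) :=
          mul_le_mul_of_nonneg_left one_add_fderiv_le_slopeFactor_mul h0
      _ = (Real.exp (C * φ y τ) - 1) * slopeFactor (fun y => u y τ) y * slopeFactor f x := by ring
      _ ≤ (Real.exp (C * φ x t) - 1) * slopeFactor f x * slopeFactor f x :=
          mul_le_mul_of_nonneg_right h1 slopeFactor_pos.le
      _ = _ := by rw [mul_assoc, slopeFactor_mul_self, hVx]
  have hηpos : ∀ y τ, 0 < φ y τ → 0 < Real.exp (C * φ y τ) - 1 := fun y τ h =>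
    sub_pos.2 (Real.one_lt_exp_iff.2 (mul_pos hCpos h))
  -- space conditions
  have hφcont : ContinuousAt (fun y => φ y t) x := by
    have h1 : ContinuousAt f x := hfx.continuousAt
    rw [hφdef]
    unfold flowCutoff
    exact (((continuousAt_const.sub ((continuous_norm.continuousAt.pow 2).div_const _)).const_mul
      _).add ((h1.sub continuousAt_const).div_const _)).sub continuousAt_const
  have hlocal : IsLocalMax (fun y => (Real.exp (C * φ y t) - 1) * V y t) x := by
    filter_upwards [hspace, hφcont.eventually (lt_mem_nhds hφ)] with y h1 h2
    exact hcomp y t (hηpos y t h2).le h1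
  have hconds : ∀ i, _ ∧ _ := fun i => by
    have hx0 : x + (0 : ℝ) • frameVector R i = x := by simp
    have hlinec : ContinuousAt (fun s : ℝ => x + s • frameVector R i) 0 :=
      (hasDerivAt_line x _ 0).continuousAt
    have hnear : ∀ᶠ s in 𝓝 (0 : ℝ), ContDiffAt ℝ 3 f (x + s • frameVector R i) := by
      have := hfx.eventually (by simp)
      rw [← hx0] at this
      exact hlinec.eventually this
    have hloc : IsLocalMax (fun s : ℝ => (Real.exp (C * φ (x + s • frameVector R i) t) - 1)
        * V (x + s • frameVector R i) t) 0 := by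
      have h1 : IsMaxFilter (fun y => (Real.exp (C * φ y t) - 1) * V y t)
        (𝓝 (x + (0 : ℝ) • frameVector R i)) (x + (0 : ℝ) • frameVector R i) := by
          rw [hx0]; exact hlocal
      exact hlinec.eventually h1
    exact isLocalMax_exp_mul_conditions hloc
      (hnear.mono fun s hs => hasDerivAt_flowCutoff_line hs rfl)
      (hasDerivAt_deriv_flowCutoff_line hfx)
      (hnear.mono fun s hs => (hs.hasDerivAt_fderiv_line rfl p).const_add 1)
      (hfx.hasDerivAt_fderiv_fderiv_line hx0 (frameVector R i) p)
  simp only [zero_smul, add_zero] at hconds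
  -- time condition
  have htimeV := (hu.hasDerivWithinAt_fderiv hk hadm hx ht hf hp hR hlam).const_add 1
  have htimeφ : HasDerivWithinAt (fun τ => φ x τ) (1 / T * (1 - ‖x‖ ^ 2 / r ^ 2)
      + flowSpeed k (coordJet f x) / (2 * N)) (Ioc 0 T) t :=
    ((((hasDerivWithinAt_id t _).div_const T).mul_const _).add
      (((hu.hasDerivWithinAt_time hk hx ht).sub_const m).div_const (2 * N))).sub_const (1 / 4)
  have htimeF := ((htimeφ.const_mul C).exp.sub_const 1).mul htimeV
  have hleft : ∀ᶠ τ in 𝓝[Iio t] t,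
      (Real.exp (C * φ x τ) - 1) * V x τ ≤ (Real.exp (C * φ x t) - 1) * V x t := by
    have hc : ContinuousWithinAt (fun τ => φ x τ) (Iio t) t := by
      have h1 := htimeφ.continuousWithinAt.mono (s := Ioo 0 t)
        fun τ hτ => ⟨hτ.1, hτ.2.le.trans ht.2⟩
      rwa [ContinuousWithinAt, nhdsWithin_Ioo_eq_nhdsLT ht.1] at h1
    filter_upwards [htime, hc.eventually (lt_mem_nhds hφ)] with τ h1 h2
    exact hcomp x τ (hηpos x τ h2).le h1
  set φt := 1 / T * (1 - ‖x‖ ^ 2 / r ^ 2) + flowSpeed k (coordJet f x) / (2 * N) with hφt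
  set Vt := ∑ i, quotDeriv lam k i *
    (fderiv ℝ (fderiv ℝ (fderiv ℝ f)) x p (frameVector R i) (frameVector R i)
      - 2 / (1 + ‖p‖ ^ 2) * (fderiv ℝ (fderiv ℝ f) x p (frameVector R i)) ^ 2) with hVt
  have hnonneg : 0 ≤ C * φt * Real.exp (C * φ x t) * V x t
      + (Real.exp (C * φ x t) - 1) * Vt := by
    refine (htimeF.nonneg_of_le_left ht hleft).trans_eq ?_
    change Real.exp (C * φ x t) * (C * φt) * V x t + (Real.exp (C * φ x t) - 1) * Vt = _
    ring
  -- the maximum principle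
  have hD3 : ∀ i, fderiv ℝ (fderiv ℝ (fderiv ℝ f)) x (frameVector R i) (frameVector R i) p
      = fderiv ℝ (fderiv ℝ (fderiv ℝ f)) x p (frameVector R i) (frameVector R i) := fun i => by
    rw [hfx.fderiv_fderiv_fderiv_swap_right, hfx.fderiv_fderiv_fderiv_swap_left]
  have hD2 : ∀ i, fderiv ℝ (fderiv ℝ f) x (frameVector R i) p
      = V x t * (lam i * inner ℝ p (frameVector R i)) := fun i => by
    rw [hfx.fderiv_fderiv_comm, clm_frameVector, hVx, inner_frameVector, hp,
      ← hessianMatrix_mulVec_gradient hfx, frame_mulVec_hessian hR hlam, gradient_dotProduct_self]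
  have hD2' : ∀ i, fderiv ℝ (fderiv ℝ f) x (frameVector R i) (frameVector R i) = lam i := by
    intro i
    rw [clm_frameVector_frameVector]
    have : (of fun j l => fderiv ℝ (fderiv ℝ f) x (EuclideanSpace.single j 1)
        (EuclideanSpace.single l 1)) = hessianMatrix f x := by
      ext j l; exact (hessianMatrix_apply j l).symm
    rw [this, hlam, diagonal_apply_eq]
  set z : EuclideanSpace ℝ (Fin n) := (-(2 * (t / T) / r ^ 2)) • x + (1 / (2 * N)) • p with hz
  have hφ₁ : ∀ i, t / T * (-(2 * inner ℝ x (frameVector R i) / r ^ 2))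
      + fderiv ℝ f x (frameVector R i) / (2 * N) = inner ℝ z (frameVector R i) := by
    intro i
    rw [fderiv_eq_inner_gradient, ← hp, hz, inner_add_left, real_inner_smul_left,
      real_inner_smul_left]
    ring
  have hsum := sum_inner_frameVector_mul hR
  have htT : t / T ≤ 1 := (div_le_one hT).2 ht.2
  have htT0 : 0 ≤ t / T := div_nonneg ht.1.le hT.le
  have hxr : ‖x‖ < r := by simpa using hx
  have hp8 : 8 ≤ ‖p‖ := by
    refine le_trans ?_ hlarge.le
    rw [le_div_iff₀ hr]; linarith
  -- The sum is ⟨p, Dφ⟩/(1 + |p|²). The part of Dφ coming from u contributes |p|²/(2N) to the inner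
  -- product; |p| > 8N/r makes the part from |x|² cost at most half of it, and |p| ≥ 1 absorbs the
  -- denominator.
  have hβ : 1 / (8 * N) ≤ ∑ i, inner ℝ p (frameVector R i) * (t / T * (-(2 * inner ℝ x
      (frameVector R i) / r ^ 2)) + fderiv ℝ f x (frameVector R i) / (2 * N)) := by
    simp only [hφ₁]
    rw [hsum z, hz, inner_add_right, real_inner_smul_right, real_inner_smul_right,
      real_inner_self_eq_norm_sq]
    have h1 : inner ℝ p x ≤ ‖p‖ * r :=
      (real_inner_le_norm p x).trans (mul_le_mul_of_nonneg_left hxr.le (norm_nonneg _))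
    have h2 : 2 * (t / T) / r ^ 2 * inner ℝ p x ≤ 2 * ‖p‖ / r := by
      calc 2 * (t / T) / r ^ 2 * inner ℝ p x ≤ 2 * (t / T) / r ^ 2 * (‖p‖ * r) := by gcongr
        _ ≤ 2 * 1 / r ^ 2 * (‖p‖ * r) := by gcongr
        _ = _ := by field_simp
    have h3 : 2 * ‖p‖ / r ≤ ‖p‖ ^ 2 / (4 * N) := by
      rw [div_lt_iff₀ hr] at hlarge
      rw [div_le_div_iff₀ hr (by positivity)]
      nlinarith [norm_nonneg p]
    have h4 : 1 / (2 * N) * ‖p‖ ^ 2 = ‖p‖ ^ 2 / (4 * N) + ‖p‖ ^ 2 / (4 * N) := by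
      field_simp; ring
    have h5 : (1 : ℝ) / (8 * N) * (1 + ‖p‖ ^ 2) ≤ ‖p‖ ^ 2 / (4 * N) := by
      rw [div_mul_eq_mul_div, one_mul, div_le_div_iff₀ (by positivity) (by positivity)]
      have h6 : 0 ≤ ‖p‖ ^ 2 - 1 := by nlinarith
      nlinarith [mul_nonneg hNpos.le h6]
    rw [le_div_iff₀ (by positivity)]
    linarith
  have hp2 : ∑ i, inner ℝ p (frameVector R i) ^ 2 ≤ 1 := by
    have := hsum p
    simp only [← sq] at this
    rw [this, real_inner_self_eq_norm_sq, div_le_one (by positivity)]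
    linarith
  have hmax := maximum_principle_inequality (a := quotDeriv lam k) (lam := lam)
    (p := fun i => inner ℝ p (frameVector R i)) (c := 1 / (n : ℝ)) (β := 1 / (8 * N))
    (η := Real.exp (C * φ x t) - 1) (E := Real.exp (C * φ x t)) (V := V x t) (C := C)
    (φt := φt) (Vt := Vt)
    (fun i => quotDeriv_nonneg lam i)
    (fun i hi => by
      have := quotDeriv_ge_of_nonpos (k := k) (fun l hl => hS l (by omega)) hi
      rwa [hcardn] at this)
    (by positivity) hCpos (Real.exp_pos _) (hηpos x t hφ) (by rw [hVx]; positivity)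
    (fun i => (hconds i).1) (fun i => (hconds i).2) hD2
    (by
      refine Finset.sum_congr rfl fun i _ => ?_
      rw [hD3, hVx, hfx.fderiv_fderiv_comm])
    hnonneg hp2 (by positivity) hβ
  rw [← hf] at hmax
  simp only [hD2'] at hmax
  have hsum2 : ∑ i, quotDeriv lam k i * (t / T * (-(2 * ‖frameVector R i‖ ^ 2 / r ^ 2))
      + lam i / (2 * N)) = -(2 * (t / T) / r ^ 2) * ∑ i, quotDeriv lam k i * ‖frameVector R i‖ ^ 2
        + flowSpeed k (coordJet f x) / (2 * N) := by
    rw [hspeed, Finset.mul_sum, Finset.sum_div, ← Finset.sum_add_distrib]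
    exact Finset.sum_congr rfl fun i _ => by ring
  have htr : ∑ i, quotDeriv lam k i * ‖frameVector R i‖ ^ 2 ≤ n := by
    refine le_trans (Finset.sum_le_sum fun i _ => ?_)
      ((sum_quotDeriv_le hkc hS).trans_eq (by rw [hcardn]))
    exact mul_le_of_le_one_right (quotDeriv_nonneg lam i) (norm_frameVector_sq_le hR i)
  rw [hsum2] at hmax
  have h1 : 2 * (t / T) / r ^ 2 * ∑ i, quotDeriv lam k i * ‖frameVector R i‖ ^ 2
      ≤ 2 * n / r ^ 2 := by
    calc _ ≤ 2 * (t / T) / r ^ 2 * n := by gcongr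
      _ ≤ 2 * 1 / r ^ 2 * n := by gcongr
      _ = _ := by ring
  have h2 : 1 / T * (1 - ‖x‖ ^ 2 / r ^ 2) ≤ 1 / T := by
    have : 0 ≤ 1 / T * (‖x‖ ^ 2 / r ^ 2) := by positivity
    linarith
  -- `C` is chosen so that this exceeds 1/T + 2n/r², the bound for the remaining terms.
  have h3 : C * (1 / (n : ℝ) * (1 / (8 * N)) ^ 2) = (2 * n + 1) * (1 / T + 1 / r ^ 2) := by
    rw [hC]; field_simp; ring
  rw [h3] at hmax
  have h4 : 0 < 1 / T := by positivity
  have h5 : 0 < 1 / r ^ 2 := by positivity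
  have h6 : 2 * (n : ℝ) / r ^ 2 = 2 * n * (1 / r ^ 2) := by ring
  rw [h6] at h1
  nlinarith [mul_pos (lt_of_lt_of_le one_pos hn) h4]

end testFunction

/-! ### The interior gradient estimate -/

section estimate

open Filter Topology

variable {n k : ℕ} {r T : ℝ} {u : EuclideanSpace ℝ (Fin n) → ℝ → ℝ}

theorem IsGraphicalFlow.continuousOn_slopeFactor (hu : IsGraphicalFlow k r T u) :
    ContinuousOn (fun z : EuclideanSpace ℝ (Fin n) × ℝ => slopeFactor (fun y => u y z.2) z.1)
      (flowCylinder n r T) := by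
  have h : ContinuousOn (fun z : EuclideanSpace ℝ (Fin n) × ℝ => ∑ i,
      (fderiv ℝ (fun y => u y z.2) z.1 (EuclideanSpace.single i 1)) ^ 2) (flowCylinder n r T) :=
    continuousOn_finsetSum _ fun i _ => (hu.continuousOn_fderiv _).pow 2
  refine ((h.const_add 1).sqrt).congr fun z _ => ?_
  rw [slopeFactor, EuclideanSpace.real_norm_sq_eq]
  simp only [gradient_apply]

theorem IsGraphicalFlow.continuousOn_flowCutoff (hu : IsGraphicalFlow k r T u) (m N : ℝ) :
    ContinuousOn (fun z : EuclideanSpace ℝ (Fin n) × ℝ => flowCutoff u r T m N z.1 z.2)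
      (flowCylinder n r T) := by
  have h := hu.continuousOn_self
  unfold flowCutoff
  have h1 : Continuous fun z : EuclideanSpace ℝ (Fin n) × ℝ =>
      z.2 / T * (1 - ‖z.1‖ ^ 2 / r ^ 2) := by fun_prop
  exact (h1.continuousOn.add ((h.sub continuousOn_const).div_const _)).sub continuousOn_const

theorem IsGraphicalFlow.mono {t : ℝ} (hu : IsGraphicalFlow k r T u) (ht : t ≤ T) :
    IsGraphicalFlow k r t u where
  contDiffOn τ hτ := hu.contDiffOn τ ⟨hτ.1, hτ.2.trans ht⟩
  continuousOn j hj := (hu.continuousOn j hj).mono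
    (prod_mono subset_rfl (Ioc_subset_Ioc_right ht))
  equation x hx τ hτ := (hu.equation x hx τ ⟨hτ.1, hτ.2.trans ht⟩).mono (Ioc_subset_Ioc_right ht)

/-- The gradient estimate at the centre of the cylinder and at the final time. -/
theorem IsGraphicalFlow.norm_gradient_le (hk : k < n) (hr : 0 < r) (hT : 0 < T)
    (hu : IsGraphicalFlow k r T u)
    (hadm : ∀ x ∈ Metric.ball (0 : EuclideanSpace ℝ (Fin n)) r, ∀ t ∈ Ioc 0 T,
      principalCurvatures (fun y => u y t) x ∈ gammaCone (k + 1))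
    {m N : ℝ} (hN : r ≤ N)
    (hum : ∀ x ∈ Metric.ball (0 : EuclideanSpace ℝ (Fin n)) r, ∀ t ∈ Ioc 0 T,
      u x t ≤ m ∧ m - N ≤ u x t) :
    ‖gradient (fun y => u y T) 0‖
      ≤ Real.exp (64 * N ^ 2 * n * (2 * n + 1) * (1 / T + 1 / r ^ 2) + 8 * N / r) := by
  obtain ⟨C, hC⟩ : ∃ C, C = 64 * N ^ 2 * n * (2 * n + 1) * (1 / T + 1 / r ^ 2) := ⟨_, rfl⟩
  rw [← hC]
  have hNpos : 0 < N := hr.trans_le hN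
  have hn : (1 : ℝ) ≤ n := by exact_mod_cast (by omega : 1 ≤ n)
  -- This makes exp(C/4) - 1 at least 1, so the test function at (0, T) dominates w there.
  have hC4 : 4 ≤ C := by
    have h1 : 1 ≤ N ^ 2 * (1 / T + 1 / r ^ 2) := by
      have h2 : 1 ≤ N ^ 2 * (1 / r ^ 2) := by
        rw [mul_one_div, one_le_div (by positivity)]; gcongr
      have h3 : 0 ≤ N ^ 2 * (1 / T) := by positivity
      linarith
    have h4 : 1 ≤ (n : ℝ) * (2 * n + 1) := by nlinarith
    have h5 : 1 ≤ (N ^ 2 * (1 / T + 1 / r ^ 2)) * (n * (2 * n + 1)) := one_le_mul_of_one_le_of_one_le h1 h4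
    rw [hC]; linarith
  set φ := flowCutoff u r T m N with hφdef
  set F : EuclideanSpace ℝ (Fin n) × ℝ → ℝ := fun z =>
    (Real.exp (C * φ z.1 z.2) - 1) * slopeFactor (fun y => u y z.2) z.1 with hF
  -- Where φ > 0 one has |x|² < (3/4) r² and t > T/4, and 9/10 exceeds √3/2. So the maximum over
  -- this compact set is one over the whole cylinder.
  set K : Set (EuclideanSpace ℝ (Fin n) × ℝ) :=
    Metric.closedBall 0 (9 / 10 * r) ×ˢ Icc (T / 4) T with hK
  have hKcyl : K ⊆ flowCylinder n r T := by
    rintro ⟨x, t⟩ ⟨hx, ht⟩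
    simp only [mem_closedBall_zero_iff] at hx
    exact ⟨by simp only [mem_ball_zero_iff]; linarith, by linarith [ht.1], ht.2⟩
  have hKcomp : IsCompact K := (isCompact_closedBall _ _).prod isCompact_Icc
  have hFcont : ContinuousOn F K :=
    (((((hu.continuousOn_flowCutoff m N).const_mul C).rexp).sub continuousOn_const).mul
      hu.continuousOn_slopeFactor).mono hKcyl
  have h0T : ((0 : EuclideanSpace ℝ (Fin n)), T) ∈ K :=
    ⟨by simp only [mem_closedBall_zero_iff, norm_zero]; linarith, by linarith, le_rfl⟩
  have h0cyl := hKcyl h0T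
  obtain ⟨⟨x, t⟩, hz, hzmax⟩ := hKcomp.exists_isMaxOn ⟨_, h0T⟩ hFcont
  have hx : x ∈ Metric.ball 0 r := (hKcyl hz).1
  have ht : t ∈ Ioc 0 T := (hKcyl hz).2
  -- At the centre and final time φ ≥ 1 - 1/2 - 1/4.
  have hφ0 : 1 / 4 ≤ φ 0 T := by
    have h := (hum 0 h0cyl.1 T h0cyl.2).2
    have h2 : -(1 / 2) ≤ (u 0 T - m) / (2 * N) := by
      rw [le_div_iff₀ (by positivity)]; linarith
    simp only [hφdef, flowCutoff, div_self hT.ne', norm_zero]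
    norm_num
    linarith
  have hF0 : (Real.exp (C * (1 / 4)) - 1) * slopeFactor (fun y => u y T) 0 ≤ F (0, T) := by
    refine mul_le_mul_of_nonneg_right (sub_le_sub_right (Real.exp_le_exp.2 ?_) _) slopeFactor_pos.le
    exact mul_le_mul_of_nonneg_left hφ0 (by linarith)
  have hexp : 1 ≤ Real.exp (C * (1 / 4)) - 1 := by
    have := Real.add_one_le_exp (C * (1 / 4))
    linarith
  have hFpos : 0 < F (0, T) :=
    lt_of_lt_of_le (mul_pos (by linarith) slopeFactor_pos) hF0
  have hFle : F (0, T) ≤ F (x, t) := hzmax h0T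
  have hφpos : 0 < φ x t := by
    by_contra! hneg
    have h1 : Real.exp (C * φ x t) - 1 ≤ 0 := by
      rw [sub_nonpos, Real.exp_le_one_iff]
      exact mul_nonpos_of_nonneg_of_nonpos (by linarith) hneg
    have : F (x, t) ≤ 0 := mul_nonpos_of_nonpos_of_nonneg h1 slopeFactor_pos.le
    linarith
  have hglobal : ∀ z ∈ flowCylinder n r T, F z ≤ F (x, t) := by
    rintro ⟨y, τ⟩ ⟨hy, hτ⟩
    rcases le_or_gt (φ y τ) 0 with h | h
    · have h1 : Real.exp (C * φ y τ) - 1 ≤ 0 := by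
        rw [sub_nonpos, Real.exp_le_one_iff]
        exact mul_nonpos_of_nonneg_of_nonpos (by linarith) h
      have : F (y, τ) ≤ 0 := mul_nonpos_of_nonpos_of_nonneg h1 slopeFactor_pos.le
      linarith
    · refine hzmax ?_
      have h1 : (u y τ - m) / (2 * N) ≤ 0 :=
        div_nonpos_of_nonpos_of_nonneg (by linarith [(hum y hy τ hτ).1]) (by positivity)
      have h2 : 1 / 4 < τ / T * (1 - ‖y‖ ^ 2 / r ^ 2) := by
        simp only [hφdef, flowCutoff] at h; linarith
      have hτT : τ / T ≤ 1 := (div_le_one hT).2 hτ.2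
      have hτ0 : 0 < τ / T := div_pos hτ.1 hT
      have hy1 : 0 ≤ ‖y‖ ^ 2 / r ^ 2 := by positivity
      have h3 : 1 / 4 < τ / T := by nlinarith
      have h4 : 1 / 4 < 1 - ‖y‖ ^ 2 / r ^ 2 := by nlinarith
      have h5 : ‖y‖ ^ 2 < 3 / 4 * r ^ 2 := by
        rw [← div_lt_iff₀ (by positivity)]; linarith
      rw [lt_div_iff₀ hT] at h3
      refine ⟨?_, by linarith, hτ.2⟩
      simp only [mem_closedBall_zero_iff]
      exact abs_le_of_sq_le_sq' (by nlinarith) (by positivity) |>.2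
  have hgrad := hu.norm_gradient_le_of_isLocalMax hk hr hT hadm hx ht hN hC hφpos
    (by
      filter_upwards [Metric.isOpen_ball.mem_nhds hx] with y hy using hglobal (y, t) ⟨hy, ht⟩)
    (by
      filter_upwards [Ioo_mem_nhdsLT ht.1] with τ hτ using
        hglobal (x, τ) ⟨hx, hτ.1, hτ.2.le.trans ht.2⟩)
  -- comparison of the values of the test function
  have hslope : slopeFactor (fun y => u y t) x ≤ 1 + 8 * N / r := by
    refine Real.sqrt_le_iff.2 ⟨by positivity, ?_⟩
    have := norm_nonneg (gradient (fun y => u y t) x)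
    nlinarith
  have hφle : φ x t ≤ 3 / 4 := by
    have h1 : (u x t - m) / (2 * N) ≤ 0 :=
      div_nonpos_of_nonpos_of_nonneg (by linarith [(hum x hx t ht).1]) (by positivity)
    have h2 : t / T * (1 - ‖x‖ ^ 2 / r ^ 2) ≤ 1 := by
      have hτT : t / T ≤ 1 := (div_le_one hT).2 ht.2
      have hτ0 : 0 < t / T := div_pos ht.1 hT
      have hy1 : 0 ≤ ‖x‖ ^ 2 / r ^ 2 := by positivity
      nlinarith
    simp only [hφdef, flowCutoff]; linarith
  have hFx : F (x, t) ≤ Real.exp C * Real.exp (8 * N / r) := by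
    have h1 : Real.exp (C * φ x t) - 1 ≤ Real.exp C := by
      have : Real.exp (C * φ x t) ≤ Real.exp C := Real.exp_le_exp.2 (by nlinarith)
      linarith
    have h2 : 1 + 8 * N / r ≤ Real.exp (8 * N / r) := by
      linarith [Real.add_one_le_exp (8 * N / r)]
    exact mul_le_mul h1 (hslope.trans h2) slopeFactor_pos.le (Real.exp_pos _).le
  have hw : ‖gradient (fun y => u y T) 0‖ ≤ slopeFactor (fun y => u y T) 0 :=
    Real.le_sqrt_of_sq_le (by linarith)
  rw [Real.exp_add]
  nlinarith [slopeFactor_pos (f := fun y => u y T) (x := 0)]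

end estimate

theorem proposition3p2 (n k : ℕ) (hk : k < n) :
    ∃ K : ℝ, 0 < K ∧
      ∀ (r T : ℝ), 0 < r → 0 < T →
      ∀ u : EuclideanSpace ℝ (Fin n) → ℝ → ℝ,
        IsGraphicalFlow k r T u →
        (∀ x ∈ Metric.ball (0 : EuclideanSpace ℝ (Fin n)) r, ∀ t ∈ Set.Ioc 0 T,
          principalCurvatures (fun y => u y t) x ∈ gammaCone (k + 1)) →
        BddAbove (flowValues r T u) → BddBelow (flowValues r T u) →
        ∀ M : ℝ, M = sSup (flowValues r T u) - sInf (flowValues r T u) →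
        ∀ t ∈ Set.Ioc 0 T,
          ‖gradient (fun y => u y t) 0‖ ≤
            Real.exp (K + K * M * T / (r * t)
              + K * (M * r * T / t + M ^ 2 / t + (T + 1) * r ^ 2 / t
                + T * M ^ 2 / (t * r ^ 2) + T * M / (t * r))) := by
  -- With A = 64 n (2n + 1), the exponent `C` is at most 2A times 1 + M²/t + r²/t + M²/r², and the
  -- term 8N/r at most 12 times the same sum.
  refine ⟨2 * (64 * n * (2 * n + 1)) + 12, by positivity, ?_⟩
  intro r T hr hT u hu hadm hA hB M hM t ht
  have hmem : ∀ x ∈ Metric.ball (0 : EuclideanSpace ℝ (Fin n)) r, ∀ τ ∈ Ioc 0 T,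
      u x τ ∈ flowValues r T u := fun x hx τ hτ => ⟨(x, τ), ⟨hx, hτ⟩, rfl⟩
  have h0 : (0 : EuclideanSpace ℝ (Fin n)) ∈ Metric.ball 0 r := Metric.mem_ball_self hr
  have hM0 : 0 ≤ M := by
    have h1 := le_csSup hA (hmem 0 h0 t ht)
    have h2 := csInf_le hB (hmem 0 h0 t ht)
    linarith
  have hsub : ∀ τ ∈ Ioc 0 t, τ ∈ Ioc 0 T := fun τ hτ => ⟨hτ.1, hτ.2.trans ht.2⟩
  -- The estimate is used on the cylinder that ends at time t. The choice N = M + r bounds the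
  -- oscillation and also gives r ≤ N when M is small.
  have hmain := (hu.mono ht.2).norm_gradient_le hk hr ht.1
    (fun x hx τ hτ => hadm x hx τ (hsub τ hτ)) (m := sSup (flowValues r T u)) (N := M + r)
    (by linarith) (fun x hx τ hτ => ⟨le_csSup hA (hmem x hx τ (hsub τ hτ)), by
      have := csInf_le hB (hmem x hx τ (hsub τ hτ))
      linarith⟩)
  refine hmain.trans (Real.exp_le_exp.2 ?_)
  have ht0 := ht.1
  obtain ⟨A, hA'⟩ : ∃ A : ℝ, A = 64 * n * (2 * n + 1) := ⟨_, rfl⟩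
  have hApos : 0 ≤ A := by rw [hA']; positivity
  rw [← hA']
  have e1 : 64 * (M + r) ^ 2 * (n : ℝ) * (2 * n + 1) * (1 / t + 1 / r ^ 2)
      = A * ((M + r) ^ 2 * (1 / t + 1 / r ^ 2)) := by rw [hA']; ring
  have e2 : (M + r) ^ 2 * (1 / t + 1 / r ^ 2)
      ≤ 2 * (1 + M ^ 2 / t + r ^ 2 / t + M ^ 2 / r ^ 2) := by
    calc (M + r) ^ 2 * (1 / t + 1 / r ^ 2)
        ≤ (2 * (M ^ 2 + r ^ 2)) * (1 / t + 1 / r ^ 2) := by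
          gcongr; nlinarith [sq_nonneg (M - r)]
      _ = _ := by field_simp; ring
  have e3 : 8 * (M + r) / r ≤ 12 * (1 + M ^ 2 / t + r ^ 2 / t + M ^ 2 / r ^ 2) := by
    have h1 : 8 * (M + r) / r = 8 * (M / r) + 8 := by field_simp
    have h2 : M ^ 2 / r ^ 2 = (M / r) ^ 2 := by rw [div_pow]
    have h3 : 0 ≤ M ^ 2 / t := by positivity
    have h4 : 0 ≤ r ^ 2 / t := by positivity
    rw [h1, h2]
    nlinarith [sq_nonneg (M / r - 1)]
  have e4 : M ^ 2 / r ^ 2 ≤ T * M ^ 2 / (t * r ^ 2) := by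
    rw [mul_div_mul_comm]
    exact le_mul_of_one_le_left (by positivity) ((one_le_div ht0).2 ht.2)
  have e5 : r ^ 2 / t ≤ (T + 1) * r ^ 2 / t := by
    gcongr
    nlinarith [sq_nonneg r]
  have e6 : 0 ≤ M * r * T / t := by positivity
  have e7 : 0 ≤ T * M / (t * r) := by positivity
  have e8 : 0 ≤ (2 * A + 12) * M * T / (r * t) := by positivity
  have e9 := mul_le_mul_of_nonneg_left e2 hApos
  -- The factor T/t ≥ 1 takes care of M²/r²; the terms linear in M enter only through their sign.
  have e10 : 1 + M ^ 2 / t + r ^ 2 / t + M ^ 2 / r ^ 2 ≤ 1 + (M * r * T / t + M ^ 2 / t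
      + (T + 1) * r ^ 2 / t + T * M ^ 2 / (t * r ^ 2) + T * M / (t * r)) := by linarith
  have e11 := mul_le_mul_of_nonneg_left e10 (by positivity : 0 ≤ 2 * A + 12)
  rw [e1]
  linarith
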